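/- Proposition 4.1 (monotonicity of the Hamiltonian under the $f^{*\phi_f}$ rearrangement). For $f:\mathbb R^3\times\mathbb R^3\to\mathbb R$ put $\rho_f(x)=\int f(x,v)\,dv$, $\phi_f(x)=-\int\frac{\rho_f(y)}{4\pi|x-y|}\,dy$ and $$\mathcal H(f)=\frac12\int_{\mathbb R^6}|v|^2f\,dx\,dv-\frac12\int_{\mathbb R^3}|\nabla\phi_f|^2\,dx .$$ Let $\mathcal E_{rad}$ be the set of measurable $f\ge 0$ (a.e.) with $f\in L^1\cap L^\infty(\mathbb R^6)$ and $|v|^2f\in L^1(\mathbb R^6)$ that are spherically symmetric, i.e. $f(x,v)=F(|x|,|v|,x\cdot v)$ for a.e. $(x,v)$ and some Borel function $F$. For $r>0$, $u\in\mathbb R$, $r^2u^2>\ell$, write $f(r,u,\ell)=F\bigl(r,|u|,\operatorname{sign}(u)\sqrt{r^2u^2-\ell}\bigr)$. For $\ell>0$ let $\nu_\ell$ be the measure $d\nu_\ell=4\pi^2\,\mathbf 1_{r^2u^2>\ell}\,(r^2u^2-\ell)^{-1/2}\,r|u|\,dr\,du$ on $(0,\infty)\times\mathbb R$, let $\mu_f(s,\ell)=\nu_\ell\{(r,u):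 f(r,u,\ell)>s\}$ for $s\ge0$, and let $$f^*(t,\ell)=\sup\{s\ge 0:\mu_f(s,\ell)>t\}\ \text{ if } t<\mu_f(0,\ell),\qquad f^*(t,\ell)=0\ \text{ if } t\ge\mu_f(0,\ell)$$ (defined for a.e. $\ell>0$). For a potential $\phi=\phi_g$ with $g\in\mathcal E_{rad}$ nonzero, which is a function of $r=|x|$, let $a_\phi(e,\ell)=\nu_\ell\{(r,u)\in(0,\infty)\times\mathbb R: u^2/2+\phi(r)<e\}$ for $e<0$ and $a_\phi(e,\ell)=+\infty$ for $e\ge 0$, and define, for a.e. $(x,v)$, $$f^{*\phi}(x,v)=f^*\Bigl(a_\phi\bigl(\tfrac{|v|^2}2+\phi(x),|x\times v|^2\bigr),|x\times v|^2\Bigr)\,\mathbf 1_{\frac{|v|^2}2+\phi(x)<0},$$ $$\mathcal J_{f^*}(\phi)=\mathcal H(f^{*\phi})+\frac12\int_{\mathbb R^3}|\nabla\phi-\nabla\phi_{f^{*\phi}}|^2\,dx .$$ Let $f\in\mathcal E_{rad}$ be not a.e. zero. Then $f^{*\phi_f}\in\mathcal E_{rad}$, the fields $\phi_f$ and $\phi_{f^{*\phi_f}}$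 are differentiable on $\mathbb R^3\setminus\{0\}$ with gradients in $L^2(\mathbb R^3)$ (so that all the quantities below are well defined and finite), and $$\mathcal H(f)\ \ge\ \mathcal J_{f^*}(\phi_f)\ \ge\ \mathcal H(f^{*\phi_f}).$$ Moreover $\mathcal H(f)=\mathcal H(f^{*\phi_f})$ if and only if $f=f^{*\phi_f}$ almost everywhere. -/

import Mathlib

open MeasureTheory

noncomputable section

namespace VlasovPoisson

/-- Physical space `ℝ³` with its Euclidean norm. -/
abbrev E3 : Type := EuclideanSpace ℝ (Fin 3)

/-- The spatial density `ρ_f(x) = ∫ f(x,v) dv`. -/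
def density (f : E3 × E3 → ℝ) (x : E3) : ℝ := ∫ v : E3, f (x, v)

/-- The Poisson field `φ_f = -(1 / (4π|x|)) ∗ ρ_f`. -/
def poissonField (f : E3 × E3 → ℝ) (x : E3) : ℝ :=
  -∫ y : E3, density f y / (4 * Real.pi * ‖x - y‖)

/-- The Hamiltonian `½ ∫ |v|² f dx dv - ½ ∫ |∇φ_f|² dx`. -/
def hamiltonian (f : E3 × E3 → ℝ) : ℝ :=
  (1 / 2) * (∫ z : E3 × E3, ‖z.2‖ ^ 2 * f z)
    - (1 / 2) * ∫ x : E3, ‖gradient (poissonField f) x‖ ^ 2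

/-- The energy space: nonnegative functions with `f ∈ L¹ ∩ L^∞` and `|v|² f ∈ L¹`. -/
structure FiniteEnergy (f : E3 × E3 → ℝ) : Prop where
  nonneg : ∀ᵐ z : E3 × E3, 0 ≤ f z
  integrable : Integrable f
  essBounded : MemLp f ⊤
  kinetic : Integrable (fun z : E3 × E3 => ‖z.2‖ ^ 2 * f z)

/-- `F` is a profile of the spherically symmetric function `f`: it is Borel and
`f(x,v) = F(|x|, |v|, x·v)` for almost every `(x,v)`. -/
structure IsRadialProfile (F : ℝ × ℝ × ℝ → ℝ) (f : E3 × E3 → ℝ) : Prop where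
  measurable : Measurable F
  ae_eq : ∀ᵐ z : E3 × E3, f z = F (‖z.1‖, ‖z.2‖, inner ℝ z.1 z.2)

/-- Spherically symmetric functions of finite energy. -/
def RadialFiniteEnergy (f : E3 × E3 → ℝ) : Prop :=
  FiniteEnergy f ∧ ∃ F, IsRadialProfile F f

/-- The squared modulus of the angular momentum, `|x × v|²`. -/
def angularMomentumSq (x v : E3) : ℝ :=
  ‖WithLp.toLp 2 (crossProduct x.ofLp v.ofLp)‖ ^ 2

/-- The profile in the coordinates `(r, u, ℓ)`, where `r = |x|`, `u = |v| sign(x·v)` and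
`ℓ = |x × v|²`, so that `x·v = sign(u) (r²u² - ℓ)^{1/2}`. -/
def inRUL (F : ℝ × ℝ × ℝ → ℝ) (r u l : ℝ) : ℝ :=
  F (r, |u|, Real.sign u * Real.sqrt (r ^ 2 * u ^ 2 - l))

/-- The measure `dν_ℓ = 4π² 1_{r²u² > ℓ} (r²u² - ℓ)^{-1/2} r |u| dr du` on `(0,∞) × ℝ`. -/
def nu (l : ℝ) : Measure (ℝ × ℝ) :=
  (volume.restrict {p : ℝ × ℝ | 0 < p.1 ∧ l < p.1 ^ 2 * p.2 ^ 2}).withDensity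
    (fun p => ENNReal.ofReal
      (4 * Real.pi ^ 2 * (Real.sqrt (p.1 ^ 2 * p.2 ^ 2 - l))⁻¹ * p.1 * |p.2|))

/-- The distribution function `μ_f(s, ℓ)` at fixed `ℓ`. -/
def distribution (F : ℝ × ℝ × ℝ → ℝ) (s l : ℝ) : ENNReal :=
  nu l {p : ℝ × ℝ | s < inRUL F p.1 p.2 l}

open Classical in
/-- The Schwarz symmetrization `f^*(t, ℓ)` at fixed `ℓ`, the pseudo-inverse of `μ_f(·, ℓ)`.
For almost every `ℓ` the set below is bounded above. -/
def schwarz (F : ℝ × ℝ × ℝ → ℝ) (t : ENNReal) (l : ℝ) : ℝ :=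
  if t < distribution F 0 l then sSup {s : ℝ | 0 ≤ s ∧ t < distribution F s l} else 0

open Classical in
/-- The Jacobian `a_φ(e, ℓ)` of a radial potential `φ`: the `ν_ℓ`-measure of the set of `(r, u)`
in `(0,∞) × ℝ` with `u²/2 + φ(r) < e` when `e < 0`, and `+∞` when `e ≥ 0`. -/
def jacobian (phi : E3 → ℝ) (e l : ℝ) : ENNReal :=
  if e < 0 then
    nu l {p : ℝ × ℝ | p.2 ^ 2 / 2 + phi (EuclideanSpace.single 0 p.1) < e}
  else ⊤

/-- The microscopic energy `|v|²/2 + φ(x)`. -/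
def microEnergy (phi : E3 → ℝ) (z : E3 × E3) : ℝ := ‖z.2‖ ^ 2 / 2 + phi z.1

open Classical in
/-- The rearrangement with respect to the microscopic energy, as a function of `g = f^*` and `φ`:
`g(a_φ(|v|²/2 + φ(x), |x × v|²), |x × v|²) 1_{|v|²/2 + φ(x) < 0}`. -/
def rearrangement (g : ENNReal → ℝ → ℝ) (phi : E3 → ℝ) (z : E3 × E3) : ℝ :=
  if microEnergy phi z < 0 then
    g (jacobian phi (microEnergy phi z) (angularMomentumSq z.1 z.2)) (angularMomentumSq z.1 z.2)
  else 0

/-- `f^{*φ_f}`, the rearrangement of `f`, with profile `F`, with respect to its own microscopic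
energy `|v|²/2 + φ_f(x)`. -/
def selfRearrangement (f : E3 × E3 → ℝ) (F : ℝ × ℝ × ℝ → ℝ) : E3 × E3 → ℝ :=
  rearrangement (schwarz F) (poissonField f)

/-- The functional `J_g(φ) = H(g_φ) + ½ ∫ |∇φ - ∇φ_{g_φ}|²`, where `g_φ` is the rearrangement
above; it is used with `g = f^*`. -/
def reducedFunctional (g : ENNReal → ℝ → ℝ) (phi : E3 → ℝ) : ℝ :=
  hamiltonian (rearrangement g phi)
    + (1 / 2) * ∫ x : E3,
        ‖gradient phi x - gradient (poissonField (rearrangement g phi)) x‖ ^ 2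

/-- The gradient of `φ` exists in the classical sense off the origin and lies in `L²`. -/
def HasFiniteFieldEnergy (phi : E3 → ℝ) : Prop :=
  (∀ x : E3, x ≠ 0 → DifferentiableAt ℝ phi x) ∧ MemLp (gradient phi) 2

end VlasovPoisson

end

noncomputable section

open Set Filter Topology
open scoped ENNReal

namespace VlasovPoisson

/-! Put `E = |v|²/2 + φ_f` and let `g = f^{*φ_f}`. Expanding `½∫|∇φ_f - ∇φ_g|²`, with `∫∇φ_ρ·∇φ_σ =
-∫φ_ρ σ` for the cross term, shows that `H(f)` and `J(φ_f)` are `∫E f` and `∫E g` plus the same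
constant `½∫|∇φ_f|²`. Hence `H(f) - J(φ_f) = ∫E (f - g)` (`hamiltonian_sub_reducedFunctional`),
while `J(φ_f) - H(g)` is half an integral of a square. Everything rests on `∫E g ≤ ∫E f` and its
equality case (`integral_microEnergy_rearrangement_le`).

This is a bathtub principle at fixed angular momentum. In the coordinates `ℓ = |x × v|²`, `r = |x|`,
`w = x·v/|x|`, Lebesgue measure becomes `4π² dℓ dr dw` (`measurePreserving_radialCoords`), and `ν_ℓ`
becomes `4π² dr dw` on every fibre (`nu_preimage_radialVelocity`). On a fibre, the superlevel set
`{g > s}` consists of the lowest negative energies, up to the mass of `{f > s}`. It therefore meets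
each `{E < -t}` in at least as much mass as `{f > s}` does. Integrating in `s` and `t` compares the
binding energies `∫(-E)₊ f ≤ ∫(-E)₊ g` (`lintegral_binding_le`). Since `g` vanishes where `E ≥ 0`,
the inequality follows. Equality forces the superlevel sets to agree for almost every `s`
(`ae_eq_of_lintegral_binding_eq`).

Newton's shell theorem reduces the field to the radial variable. It gives the classical gradient off
the origin, boundedness of the potential and the energy identities without integration by parts. -/

/-! ### Integration in axial, shell and radial coordinates. -/

theorem lintegral_plane_sq (h : ℝ → ℝ≥0∞) (hh : Measurable h) :
    ∫⁻ y : ℝ × ℝ, h (y.1 ^ 2 + y.2 ^ 2) = ∫⁻ q in Ioi (0 : ℝ), ENNReal.ofReal Real.pi * h q := by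
  rw [← lintegral_comp_polarCoord_symm]
  have hpi : (0 : ℝ) ≤ Real.pi := Real.pi_pos.le
  have e1 : ∀ p : ℝ × ℝ, ENNReal.ofReal p.1 • h ((polarCoord.symm p).1 ^ 2 + (polarCoord.symm p).2 ^ 2)
      = ENNReal.ofReal p.1 * h (p.1 ^ 2) := by
    intro p
    simp only [polarCoord_symm_apply, smul_eq_mul]
    congr 2
    rw [mul_pow, mul_pow, ← mul_add, Real.cos_sq_add_sin_sq, mul_one]
  simp_rw [e1]
  rw [polarCoord_target, Measure.volume_eq_prod, ← Measure.prod_restrict,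
    lintegral_prod _ (by fun_prop)]
  simp only [lintegral_const, Measure.restrict_apply_univ, Real.volume_Ioo]
  have himg : (fun t : ℝ => t ^ 2) '' Ioi (0 : ℝ) = Ioi 0 := by
    ext q
    constructor
    · rintro ⟨t, ht, rfl⟩; exact pow_pos (mem_Ioi.1 ht) 2
    · intro hq; exact ⟨Real.sqrt q, Real.sqrt_pos.2 hq, Real.sq_sqrt (le_of_lt hq)⟩
  conv_rhs => rw [← himg]
  rw [lintegral_image_eq_lintegral_abs_deriv_mul (f' := fun t => 2 * t) measurableSet_Ioi
    (fun t _ => by simpa using (hasDerivAt_pow 2 t).hasDerivWithinAt)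
    (fun a ha b hb hab => by
      simpa using (sq_eq_sq₀ (le_of_lt (mem_Ioi.1 ha)) (le_of_lt (mem_Ioi.1 hb))).1 hab)]
  refine setLIntegral_congr_fun measurableSet_Ioi fun t ht => ?_
  have ht' : (0 : ℝ) < t := ht
  rw [abs_of_pos (by positivity), mul_right_comm, ← ENNReal.ofReal_mul ht'.le, ← mul_assoc,
    ← ENNReal.ofReal_mul (by positivity)]
  congr 2
  ring

/-- Complete `e` to an orthonormal basis. With the squared distance `q` to the axis as variable, the
area element `2πt dt` of the orthogonal plane becomes `π dq`, so the volume element has constant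
density. -/
theorem lintegral_axial (e : E3) (he : ‖e‖ = 1) (h : ℝ × ℝ → ℝ≥0∞) (hh : Measurable h) :
    ∫⁻ v : E3, h (inner ℝ e v, ‖v‖ ^ 2 - (inner ℝ e v) ^ 2)
      = ∫⁻ p : ℝ, ∫⁻ q in Ioi (0 : ℝ), ENNReal.ofReal Real.pi * h (p, q) := by
  have hon : Orthonormal ℝ (({0} : Set (Fin 3)).domRestrict (fun _ => e)) := by
    constructor
    · intro i; simpa [Set.domRestrict] using he
    · intro i j hij; exact absurd (Subsingleton.elim i j) hij
  obtain ⟨b, hb⟩ := hon.exists_orthonormalBasis_extension_of_card_eq (ι := Fin 3) (by simp)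
  have hb0 : b 0 = e := hb 0 rfl
  have e1 : ∀ v : E3, h (inner ℝ e v, ‖v‖ ^ 2 - (inner ℝ e v) ^ 2)
      = (fun w : E3 => h (w 0, (w 1) ^ 2 + (w 2) ^ 2)) (b.repr v) := by
    intro v
    have h0 : b.repr v 0 = inner ℝ e v := by rw [b.repr_apply_apply, hb0]
    have h1 : ‖v‖ ^ 2 = (b.repr v 0) ^ 2 + (b.repr v 1) ^ 2 + (b.repr v 2) ^ 2 := by
      rw [← b.repr.norm_map v, EuclideanSpace.norm_sq_eq]
      simp [Fin.sum_univ_three]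
    simp only
    rw [h1, ← h0]
    congr 2
    ring
  simp_rw [e1]
  rw [b.measurePreserving_repr.lintegral_comp (f := fun w : E3 => h (w 0, (w 1) ^ 2 + (w 2) ^ 2))
    (by fun_prop)]
  have e2 := (EuclideanSpace.volume_preserving_symm_measurableEquiv_toLp (Fin 3)).lintegral_comp
    (f := fun w : Fin 3 → ℝ => h (w 0, (w 1) ^ 2 + (w 2) ^ 2)) (by fun_prop)
  have e3 := (volume_preserving_piFinSuccAbove (fun _ : Fin 3 => ℝ) 0).lintegral_comp
    (f := fun w : ℝ × (Fin 2 → ℝ) => h (w.1, (w.2 0) ^ 2 + (w.2 1) ^ 2)) (by fun_prop)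
  refine e2.trans (e3.trans ?_)
  rw [Measure.volume_eq_prod, lintegral_prod _ (by fun_prop)]
  refine lintegral_congr fun p => ?_
  have e4 := (volume_preserving_finTwoArrow ℝ).lintegral_comp
    (f := fun w : ℝ × ℝ => h (p, w.1 ^ 2 + w.2 ^ 2)) (by fun_prop)
  refine e4.trans ?_
  exact lintegral_plane_sq (fun q => h (p, q)) (by fun_prop)

/-- Archimedes' hat-box theorem: on a sphere of radius `s` the component along an axis is uniformly
distributed. It follows from axial coordinates by `q = s² - p²` at fixed `p` and Tonelli. -/
theorem lintegral_shell (e : E3) (he : ‖e‖ = 1) (h : ℝ × ℝ → ℝ≥0∞) (hh : Measurable h) :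
    ∫⁻ v : E3, h (inner ℝ e v, ‖v‖)
      = ∫⁻ s in Ioi (0 : ℝ), ∫⁻ p in Ioo (-s) s, ENNReal.ofReal (2 * Real.pi * s) * h (p, s) := by
  have hpi : (0 : ℝ) ≤ Real.pi := Real.pi_pos.le
  have e1 : ∀ v : E3, h (inner ℝ e v, ‖v‖) = (fun y : ℝ × ℝ => h (y.1, Real.sqrt (y.1 ^ 2 + y.2)))
      (inner ℝ e v, ‖v‖ ^ 2 - (inner ℝ e v) ^ 2) := by
    intro v
    simp
  rw [lintegral_congr e1,
    lintegral_axial e he (fun y : ℝ × ℝ => h (y.1, Real.sqrt (y.1 ^ 2 + y.2))) (by fun_prop)]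
  have e2 : ∀ p : ℝ, ∫⁻ q in Ioi (0 : ℝ), ENNReal.ofReal Real.pi * h (p, Real.sqrt (p ^ 2 + q))
      = ∫⁻ s, ({y : ℝ × ℝ | |y.1| < y.2}.indicator
          fun y => ENNReal.ofReal (2 * Real.pi * y.2) * h y) (p, s) := by
    intro p
    have himg : (fun s : ℝ => s ^ 2 - p ^ 2) '' Ioi |p| = Ioi 0 := by
      ext q
      constructor
      · rintro ⟨t, ht, rfl⟩
        have : p ^ 2 < t ^ 2 := sq_lt_sq.2 (lt_of_lt_of_le ht (le_abs_self t))
        exact sub_pos.2 this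
      · intro hq
        have hq' : (0 : ℝ) < q := hq
        refine ⟨Real.sqrt (p ^ 2 + q), ?_, ?_⟩
        · rw [mem_Ioi, Real.lt_sqrt (abs_nonneg p), sq_abs]; linarith
        · simp only; rw [Real.sq_sqrt (by positivity)]; ring
    rw [← himg, lintegral_image_eq_lintegral_abs_deriv_mul (f' := fun t => 2 * t) measurableSet_Ioi
      (fun t _ => by
        simpa using ((hasDerivAt_pow 2 t).sub_const (p ^ 2)).hasDerivWithinAt)
      (fun a ha b hb hab => by
        have ha' := (abs_nonneg p).trans (le_of_lt (mem_Ioi.1 ha))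
        have hb' := (abs_nonneg p).trans (le_of_lt (mem_Ioi.1 hb))
        simp only [sub_left_inj] at hab
        exact (sq_eq_sq₀ ha' hb').1 hab), ← lintegral_indicator measurableSet_Ioi]
    refine lintegral_congr fun s => ?_
    by_cases hs : |p| < s
    · have hs0 : 0 < s := lt_of_le_of_lt (abs_nonneg p) hs
      rw [indicator_of_mem (mem_Ioi.2 hs), indicator_of_mem (by exact hs), ← mul_assoc,
        ← ENNReal.ofReal_mul (abs_nonneg _), abs_of_pos (by positivity)]
      congr 2
      · ring_nf
      · simp [Real.sqrt_sq hs0.le]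
    · rw [indicator_of_notMem (by simpa using hs), indicator_of_notMem (by simpa using hs)]
  simp only
  simp_rw [e2]
  have hS : MeasurableSet {y : ℝ × ℝ | |y.1| < y.2} :=
    measurableSet_lt (by fun_prop) (by fun_prop)
  rw [lintegral_lintegral_swap]
  · rw [← lintegral_indicator measurableSet_Ioi]
    refine lintegral_congr fun s => ?_
    by_cases hs : 0 < s
    · rw [indicator_of_mem (mem_Ioi.2 hs), ← lintegral_indicator measurableSet_Ioo]
      refine lintegral_congr fun p => ?_
      by_cases hp : |p| < s
      · rw [indicator_of_mem (by exact hp), indicator_of_mem (by exact abs_lt.1 hp)]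
      · rw [indicator_of_notMem (by simpa using hp), indicator_of_notMem]
        rw [mem_Ioo, ← abs_lt]; exact hp
    · rw [indicator_of_notMem (by simpa using hs)]
      rw [lintegral_eq_zero_iff' (by
        refine Measurable.aemeasurable ?_
        exact (Measurable.indicator (by fun_prop) hS).comp (by fun_prop))]
      refine Eventually.of_forall fun p => ?_
      refine indicator_of_notMem ?_ _
      intro hp
      exact hs (lt_of_le_of_lt (abs_nonneg p) hp)
  · exact (Measurable.indicator (by fun_prop) hS).aemeasurable

theorem lintegral_radial (h : ℝ → ℝ≥0∞) (hh : Measurable h) :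
    ∫⁻ v : E3, h ‖v‖ = ∫⁻ s in Ioi (0 : ℝ), ENNReal.ofReal (4 * Real.pi * s ^ 2) * h s := by
  have hpi : (0 : ℝ) ≤ Real.pi := Real.pi_pos.le
  rw [lintegral_shell (EuclideanSpace.single 0 1) (by simp) (fun y => h y.2) (by fun_prop)]
  refine setLIntegral_congr_fun measurableSet_Ioi fun s hs => ?_
  have hs' : (0 : ℝ) < s := hs
  simp only [lintegral_const, Measure.restrict_apply_univ, Real.volume_Ioo]
  rw [mul_right_comm, ← ENNReal.ofReal_mul (by positivity)]
  congr 2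
  ring

/-! ### Newton's shell theorem and the gradient of a radial potential. -/

section

/-- A nonnegative radial density of finite mass with finite potential at the origin. -/
structure IsRadialDensity (ρ : E3 → ℝ) : Prop where
  nonneg : ∀ᵐ y, 0 ≤ ρ y
  integrable : Integrable ρ
  integrable_div_norm : Integrable fun y => ρ y / ‖y‖
  radial : ∃ R : ℝ → ℝ, Measurable R ∧ ∀ᵐ y, ρ y = R ‖y‖

/-- The Newton potential `-(1 / (4π|x|)) ∗ ρ`. -/
def newtonPotential (ρ : E3 → ℝ) (x : E3) : ℝ := -∫ y, ρ y / (4 * Real.pi * ‖x - y‖)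

/-- The radial form of the Newton potential. -/
def radialPotential (ρ : E3 → ℝ) (r : ℝ) : ℝ := -∫ y, ρ y / (4 * Real.pi * max r ‖y‖)

/-- The mass of `ρ` in the open ball of radius `r`. -/
def massInside (ρ : E3 → ℝ) (r : ℝ) : ℝ := ∫ y in {y : E3 | ‖y‖ < r}, ρ y

/-- By the hat-box theorem this computes the mean of `1/|x - y|` over the sphere `|y| = s` when `|x|
= r`. The condition `r ≠ s` keeps the integrand regular at the endpoint `p = s`. -/
theorem integral_inv_distance {r s : ℝ} (hr : 0 < r) (hs : 0 < s) (hrs : r ≠ s) :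
    ∫ p in (-s)..s, (Real.sqrt (r ^ 2 + s ^ 2 - 2 * r * p))⁻¹ = 2 * s / max r s := by
  have hpos : ∀ p ∈ uIcc (-s) s, 0 < r ^ 2 + s ^ 2 - 2 * r * p := by
    intro p hp
    rw [uIcc_of_le (by linarith)] at hp
    have : 0 < (r - s) ^ 2 := by
      have := sub_ne_zero.2 hrs
      positivity
    nlinarith [hp.2]
  have hder : ∀ p ∈ uIcc (-s) s, HasDerivAt (fun p => -(Real.sqrt (r ^ 2 + s ^ 2 - 2 * r * p)) / r)
      (Real.sqrt (r ^ 2 + s ^ 2 - 2 * r * p))⁻¹ p := by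
    intro p hp
    have h0 := hpos p hp
    have h1 : HasDerivAt (fun p => r ^ 2 + s ^ 2 - 2 * r * p) (-(2 * r)) p := by
      simpa using ((hasDerivAt_id p).const_mul (2 * r)).const_sub (r ^ 2 + s ^ 2)
    refine ((h1.sqrt h0.ne').neg.div_const r).congr_deriv ?_
    have := (Real.sqrt_pos.2 h0).ne'
    field_simp
  rw [intervalIntegral.integral_eq_sub_of_hasDerivAt hder]
  · have e1 : r ^ 2 + s ^ 2 - 2 * r * s = (r - s) ^ 2 := by ring
    have e2 : r ^ 2 + s ^ 2 - 2 * r * (-s) = (r + s) ^ 2 := by ring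
    rw [e1, e2, Real.sqrt_sq_eq_abs, Real.sqrt_sq (by positivity)]
    rcases lt_or_gt_of_ne hrs with h | h
    · rw [max_eq_right h.le, abs_of_neg (by linarith)]; field_simp; ring
    · rw [max_eq_left h.le, abs_of_pos (by linarith)]; field_simp; ring
  · refine ContinuousOn.intervalIntegrable ?_
    refine ContinuousOn.inv₀ (by fun_prop) fun p hp => (Real.sqrt_pos.2 (hpos p hp)).ne'

theorem norm_sub_eq_sqrt {x : E3} (hx : x ≠ 0) (y : E3) :
    ‖x - y‖ = Real.sqrt (‖x‖ ^ 2 + ‖y‖ ^ 2 - 2 * ‖x‖ * inner ℝ (‖x‖⁻¹ • x) y) := by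
  have hx' : ‖x‖ ≠ 0 := norm_ne_zero_iff.2 hx
  rw [real_inner_smul_left, ← Real.sqrt_sq (norm_nonneg (x - y)), norm_sub_sq_real]
  congr 1
  field_simp
  ring

/-- Newton's shell theorem, integrated over shells; the singular shell `s = ‖x‖` is negligible.
Working in `ℝ≥0∞` avoids integrability questions. -/
theorem lintegral_inv_distance_eq {x : E3} (hx : x ≠ 0) {R : ℝ → ℝ} (hR : Measurable R) :
    ∫⁻ y : E3, ENNReal.ofReal (R ‖y‖) * ENNReal.ofReal (‖x - y‖⁻¹)
      = ∫⁻ y : E3, ENNReal.ofReal (R ‖y‖) * ENNReal.ofReal ((max ‖x‖ ‖y‖)⁻¹) := by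
  have hx' : 0 < ‖x‖ := norm_pos_iff.2 hx
  have hunit : ‖‖x‖⁻¹ • x‖ = 1 := by rw [norm_smul, norm_inv, norm_norm, inv_mul_cancel₀ hx'.ne']
  have e1 : ∀ y : E3, ENNReal.ofReal (R ‖y‖) * ENNReal.ofReal (‖x - y‖⁻¹)
      = (fun z : ℝ × ℝ => ENNReal.ofReal (R z.2) *
        ENNReal.ofReal (Real.sqrt (‖x‖ ^ 2 + z.2 ^ 2 - 2 * ‖x‖ * z.1))⁻¹)
        (inner ℝ (‖x‖⁻¹ • x) y, ‖y‖) := fun y => by rw [norm_sub_eq_sqrt hx]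
  have e2 : ∀ y : E3, ENNReal.ofReal (R ‖y‖) * ENNReal.ofReal ((max ‖x‖ ‖y‖)⁻¹)
      = (fun z : ℝ × ℝ => ENNReal.ofReal (R z.2) * ENNReal.ofReal ((max ‖x‖ z.2)⁻¹))
        (inner ℝ (‖x‖⁻¹ • x) y, ‖y‖) := fun y => rfl
  rw [lintegral_congr e1, lintegral_congr e2,
    lintegral_shell _ hunit (fun z : ℝ × ℝ => ENNReal.ofReal (R z.2) *
        ENNReal.ofReal (Real.sqrt (‖x‖ ^ 2 + z.2 ^ 2 - 2 * ‖x‖ * z.1))⁻¹) (by fun_prop),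
    lintegral_shell _ hunit (fun z : ℝ × ℝ => ENNReal.ofReal (R z.2) *
        ENNReal.ofReal ((max ‖x‖ z.2)⁻¹)) (by fun_prop)]
  have hne : ∀ᵐ s : ℝ ∂(volume.restrict (Ioi 0)), s ≠ ‖x‖ :=
    ae_restrict_of_ae (Measure.ae_ne volume ‖x‖)
  refine lintegral_congr_ae ?_
  filter_upwards [hne, ae_restrict_mem measurableSet_Ioi] with s hs hs0
  have hs0' : (0 : ℝ) < s := hs0
  rw [lintegral_const_mul _ (by fun_prop), lintegral_const_mul _ (by fun_prop),
    lintegral_const_mul _ (by fun_prop), lintegral_const_mul _ (by fun_prop)]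
  congr 2
  have hpos : ∀ p ∈ uIcc (-s) s, 0 < ‖x‖ ^ 2 + s ^ 2 - 2 * ‖x‖ * p := by
    intro p hp
    rw [uIcc_of_le (by linarith)] at hp
    have : 0 < (‖x‖ - s) ^ 2 := by
      have := sub_ne_zero.2 hs.symm
      positivity
    nlinarith [hp.2]
  have hint : IntervalIntegrable (fun p => (Real.sqrt (‖x‖ ^ 2 + s ^ 2 - 2 * ‖x‖ * p))⁻¹)
      volume (-s) s :=
    ContinuousOn.intervalIntegrable
      (ContinuousOn.inv₀ (by fun_prop) fun p hp => (Real.sqrt_pos.2 (hpos p hp)).ne')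
  rw [intervalIntegrable_iff_integrableOn_Ioo_of_le (by linarith)] at hint
  rw [← ofReal_integral_eq_lintegral_ofReal hint
    (Eventually.of_forall fun p => inv_nonneg.2 (Real.sqrt_nonneg _)),
    ← integral_Ioc_eq_integral_Ioo, ← intervalIntegral.integral_of_le (by linarith),
    integral_inv_distance hx' hs0' hs.symm]
  simp only [lintegral_const, Measure.restrict_apply_univ, Real.volume_Ioo]
  rw [← ENNReal.ofReal_mul (by positivity)]
  congr 1
  ring

variable {ρ ρ' : E3 → ℝ}

theorem newtonPotential_eq_radialPotential (hρ : IsRadialDensity ρ) {x : E3} (hx : x ≠ 0) :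
    newtonPotential ρ x = radialPotential ρ ‖x‖ := by
  obtain ⟨R, hR, hρR⟩ := hρ.radial
  have hpi := Real.pi_pos
  have key : ∀ k : E3 → ℝ, Measurable k → (∀ y, 0 ≤ k y) →
      ∫ y, ρ y / (4 * Real.pi * k y)
        = (4 * Real.pi)⁻¹ * (∫⁻ y, ENNReal.ofReal (R ‖y‖) * ENNReal.ofReal (k y)⁻¹).toReal := by
    intro k hk hk0
    have e1 : ∀ᵐ y, ρ y / (4 * Real.pi * k y) = (4 * Real.pi)⁻¹ * (R ‖y‖ * (k y)⁻¹) := by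
      filter_upwards [hρR] with y hy
      rw [hy]; field_simp
    rw [integral_congr_ae e1, integral_const_mul, integral_eq_lintegral_of_nonneg_ae]
    · congr 2
      refine lintegral_congr fun y => ?_
      rw [mul_comm, ENNReal.ofReal_mul (inv_nonneg.2 (hk0 y)), mul_comm]
    · filter_upwards [hρR, hρ.nonneg] with y hy hy0
      rw [hy] at hy0
      exact mul_nonneg hy0 (inv_nonneg.2 (hk0 y))
    · exact Measurable.aestronglyMeasurable (by fun_prop)
  rw [newtonPotential, radialPotential, key (fun y => ‖x - y‖) (by fun_prop) (fun y => norm_nonneg _),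
    key (fun y => max ‖x‖ ‖y‖) (by fun_prop) (fun y => by positivity),
    lintegral_inv_distance_eq hx hR]

theorem integrable_div_max (hρ : IsRadialDensity ρ) (r : ℝ) :
    Integrable fun y => ρ y / (4 * Real.pi * max r ‖y‖) := by
  have hpi := Real.pi_pos
  refine (hρ.integrable_div_norm.const_mul (4 * Real.pi)⁻¹).mono
    (hρ.integrable.aemeasurable.div (g := fun y => 4 * Real.pi * max r ‖y‖)
      (by fun_prop)).aestronglyMeasurable ?_
  filter_upwards [Measure.ae_ne volume (0 : E3)] with y hy
  have hy' : 0 < ‖y‖ := norm_pos_iff.2 hy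
  have hm : ‖y‖ ≤ max r ‖y‖ := le_max_right _ _
  have hm' : 0 < max r ‖y‖ := hy'.trans_le hm
  rw [norm_div, norm_mul (4 * Real.pi)⁻¹, norm_div, norm_norm, Real.norm_of_nonneg (by positivity : (0 : ℝ) ≤ 4 * Real.pi * max r ‖y‖),
    Real.norm_of_nonneg (by positivity : (0 : ℝ) ≤ (4 * Real.pi)⁻¹), ← div_eq_inv_mul, div_div,
    mul_comm ‖y‖]
  gcongr

theorem radialPotential_nonpos (hρ : IsRadialDensity ρ) (r : ℝ) : radialPotential ρ r ≤ 0 := by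
  have hpi := Real.pi_pos
  rw [radialPotential, neg_nonpos]
  refine integral_nonneg_of_ae ?_
  filter_upwards [hρ.nonneg] with y hy
  have : 0 ≤ max r ‖y‖ := (norm_nonneg y).trans (le_max_right _ _)
  positivity

/-- Since the potential is bounded below by its value at the origin, velocities are bounded on
negative-energy sets. -/
theorem radialPotential_ge_const (hρ : IsRadialDensity ρ) (r : ℝ) :
    -((4 * Real.pi)⁻¹ * ∫ y, ρ y / ‖y‖) ≤ radialPotential ρ r := by
  have hpi := Real.pi_pos
  rw [radialPotential, neg_le_neg_iff, ← integral_const_mul]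
  refine integral_mono_ae (integrable_div_max hρ r) (hρ.integrable_div_norm.const_mul _) ?_
  filter_upwards [hρ.nonneg, Measure.ae_ne volume (0 : E3)] with y hy hy0
  have hy' : 0 < ‖y‖ := norm_pos_iff.2 hy0
  rw [← div_eq_inv_mul, div_div, mul_comm ‖y‖]
  gcongr
  exact le_max_right _ _

/-- The decay at infinity bounds the radius on `{E < e}` when `e < 0`. -/
theorem radialPotential_ge_div (hρ : IsRadialDensity ρ) {r : ℝ} (hr : 0 < r) :
    -((∫ y, ρ y) / (4 * Real.pi * r)) ≤ radialPotential ρ r := by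
  have hpi := Real.pi_pos
  rw [radialPotential, neg_le_neg_iff, ← integral_div]
  refine integral_mono_ae (integrable_div_max hρ r) (hρ.integrable.div_const _) ?_
  filter_upwards [hρ.nonneg] with y hy
  have : 0 < max r ‖y‖ := hr.trans_le (le_max_left _ _)
  gcongr
  exact le_max_left _ _

/-- Differentiate under the integral: the kernel `1 / max r ‖y‖` is locally Lipschitz in `r > 0` and
fails to be differentiable only on the null sphere `‖y‖ = r`. Only mass inside that sphere
contributes. -/
theorem hasDerivAt_radialPotential (hρ : IsRadialDensity ρ) {r : ℝ} (hr : 0 < r) :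
    HasDerivAt (radialPotential ρ) (massInside ρ r / (4 * Real.pi * r ^ 2)) r := by
  have hpi := Real.pi_pos
  have hsphere : ∀ᵐ y : E3, ‖y‖ ≠ r := by
    rw [ae_iff]
    have : {y : E3 | ¬ ‖y‖ ≠ r} = Metric.sphere 0 r := by ext y; simp
    rw [this]
    exact Measure.addHaar_sphere _ _ _
  have hmeas : AEStronglyMeasurable ρ := hρ.integrable.aestronglyMeasurable
  have hS : MeasurableSet {y : E3 | ‖y‖ < r} := measurableSet_lt (by fun_prop) (by fun_prop)
  have h := (hasDerivAt_integral_of_dominated_loc_of_lip (μ := (volume : Measure E3))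
    (F := fun t y => ρ y / (4 * Real.pi * max t ‖y‖))
    (F' := fun y => -({y : E3 | ‖y‖ < r}.indicator ρ y / (4 * Real.pi * r ^ 2)))
    (x₀ := r) (s := Ioi (r / 2)) (bound := fun y => ‖ρ y‖ / (Real.pi * r ^ 2))
    (Ioi_mem_nhds (by linarith))
    (Eventually.of_forall fun t => (integrable_div_max hρ t).aestronglyMeasurable)
    (integrable_div_max hρ r)
    ((hρ.integrable.indicator hS).div_const _).neg.aestronglyMeasurable ?_ (hρ.integrable.norm.div_const _) ?_).2
  · have h2 := h.neg
    rw [integral_neg, neg_neg, integral_div, integral_indicator hS] at h2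
    exact h2
  · refine Eventually.of_forall fun y => ?_
    refine LipschitzOnWith.of_dist_le_mul fun t ht t' ht' => ?_
    have ht0 : r / 2 < t := ht
    have ht0' : r / 2 < t' := ht'
    set a := max t ‖y‖
    set b := max t' ‖y‖
    have ha : r / 2 < a := ht0.trans_le (le_max_left _ _)
    have hb : r / 2 < b := ht0'.trans_le (le_max_left _ _)
    have ha0 : 0 < a := by linarith
    have hb0 : 0 < b := by linarith
    have hab : |a - b| ≤ |t - t'| := by
      have := abs_max_sub_max_le_max t ‖y‖ t' ‖y‖
      simpa using this
    -- Source of the dominating constant: `1 / (4π a b) ≤ 1 / (π r²)` for parameters above `r / 2`.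
    have hprod : r ^ 2 / 4 ≤ a * b := by nlinarith
    rw [Real.dist_eq, Real.dist_eq, Real.coe_nnabs,
      abs_of_nonneg (by positivity : 0 ≤ ‖ρ y‖ / (Real.pi * r ^ 2))]
    have e1 : ρ y / (4 * Real.pi * a) - ρ y / (4 * Real.pi * b)
        = ρ y * (b - a) / (4 * Real.pi * (a * b)) := by field_simp
    rw [e1, abs_div, abs_mul, abs_of_pos (by positivity : 0 < 4 * Real.pi * (a * b)),
      div_mul_eq_mul_div, Real.norm_eq_abs, abs_sub_comm b a]
    refine div_le_div₀ (by positivity) (by gcongr) (by positivity) ?_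
    nlinarith
  · filter_upwards [hsphere] with y hy
    rcases lt_or_gt_of_ne hy with h | h
    · rw [indicator_of_mem (by exact h)]
      have h1 : HasDerivAt (fun t => ρ y / (4 * Real.pi * t)) (-(ρ y / (4 * Real.pi * r ^ 2))) r := by
        have := ((hasDerivAt_inv hr.ne').const_mul (ρ y / (4 * Real.pi)))
        refine (this.congr_deriv ?_).congr_of_eventuallyEq (Eventually.of_forall fun t => ?_)
        · field_simp
        · simp only; rw [← div_eq_mul_inv, div_div]
      refine h1.congr_of_eventuallyEq ?_
      filter_upwards [lt_mem_nhds h] with t ht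
      rw [max_eq_left ht.le]
    · rw [indicator_of_notMem (by simpa using h.le)]
      simp only [zero_div, neg_zero]
      refine (hasDerivAt_const r (ρ y / (4 * Real.pi * ‖y‖))).congr_of_eventuallyEq ?_
      filter_upwards [gt_mem_nhds h] with t ht
      rw [max_eq_right ht.le]

theorem hasGradientAt_newtonPotential (hρ : IsRadialDensity ρ) {x : E3} (hx : x ≠ 0) :
    HasGradientAt (newtonPotential ρ) ((massInside ρ ‖x‖ / (4 * Real.pi * ‖x‖ ^ 3)) • x) x := by
  have hx' : 0 < ‖x‖ := norm_pos_iff.2 hx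
  have hpi := Real.pi_pos
  have hn : HasFDerivAt (fun y : E3 => ‖y‖) (‖x‖⁻¹ • innerSL ℝ x) x := by
    have h1 := ((hasStrictFDerivAt_norm_sq x).hasFDerivAt).sqrt (by positivity)
    simp only [Real.sqrt_sq (norm_nonneg _)] at h1
    refine h1.congr_fderiv ?_
    ext v
    simp
    field_simp
  have h2 := (hasDerivAt_radialPotential hρ hx').comp_hasFDerivAt x hn
  rw [hasGradientAt_iff_hasFDerivAt]
  refine (h2.congr_of_eventuallyEq ?_).congr_fderiv ?_
  · filter_upwards [isOpen_ne.mem_nhds hx] with y hy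
    exact newtonPotential_eq_radialPotential hρ hy
  · ext v
    simp
    field_simp

theorem lintegral_Ioi_inv_sq {M : ℝ} (hM : 0 < M) :
    ∫⁻ s in Ioi M, ENNReal.ofReal (1 / (4 * Real.pi * s ^ 2))
      = ENNReal.ofReal (1 / (4 * Real.pi * M)) := by
  have hpi := Real.pi_pos
  have h1 := integrableOn_Ioi_rpow_of_lt (by norm_num : (-2 : ℝ) < -1) hM
  have h2 := integral_Ioi_rpow_of_lt (by norm_num : (-2 : ℝ) < -1) hM
  have e1 : ∀ s ∈ Ioi M, (4 * Real.pi)⁻¹ * s ^ (-2 : ℝ) = 1 / (4 * Real.pi * s ^ 2) := by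
    intro s hs
    have hs0 : 0 < s := hM.trans hs
    rw [Real.rpow_neg hs0.le]
    norm_num
    ring
  rw [← setLIntegral_congr_fun measurableSet_Ioi fun s hs => congrArg ENNReal.ofReal (e1 s hs),
    ← ofReal_integral_eq_lintegral_ofReal (h1.const_mul _), integral_const_mul, h2]
  · congr 1
    rw [show (-2 : ℝ) + 1 = -1 by norm_num, Real.rpow_neg hM.le, Real.rpow_one]
    field_simp
  · rw [EventuallyLE, ae_restrict_iff' measurableSet_Ioi]
    refine Eventually.of_forall fun s hs => ?_
    have hs0 : 0 < s := hM.trans hs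
    simp only [Pi.zero_apply]
    positivity

/-- The field energy of a unit point charge outside radius `M`: the shell factor `4πs²` cancels one
of the two factors `1 / (4πs²)`. -/
theorem lintegral_outside_inv_pow_four {M : ℝ} (hM : 0 < M) :
    ∫⁻ x : E3, {x : E3 | M < ‖x‖}.indicator
        (fun x => ENNReal.ofReal (1 / (4 * Real.pi * ‖x‖ ^ 2) ^ 2)) x
      = ENNReal.ofReal (1 / (4 * Real.pi * M)) := by
  have hpi := Real.pi_pos
  rw [← lintegral_Ioi_inv_sq hM]
  have h := lintegral_radial ((Ioi M).indicator
    fun s => ENNReal.ofReal (1 / (4 * Real.pi * s ^ 2) ^ 2))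
    (Measurable.indicator (by fun_prop) measurableSet_Ioi)
  refine Eq.trans ?_ (h.trans ?_)
  · rfl
  rw [← lintegral_indicator measurableSet_Ioi, ← lintegral_indicator measurableSet_Ioi]
  refine lintegral_congr fun s => ?_
  by_cases hs : M < s
  · have hs0 : 0 < s := hM.trans hs
    rw [indicator_of_mem (mem_Ioi.2 hs0), indicator_of_mem (mem_Ioi.2 hs),
      indicator_of_mem (mem_Ioi.2 hs), ← ENNReal.ofReal_mul (by positivity)]
    congr 1
    field_simp
  · rw [indicator_of_notMem (s := Ioi M) (a := s) (by simpa using hs)]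
    by_cases h0 : 0 < s
    · rw [indicator_of_mem (mem_Ioi.2 h0), indicator_of_notMem (by simpa using hs), mul_zero]
    · rw [indicator_of_notMem (by simpa using h0)]

end

/-! ### Field energy as potential energy. -/

section

variable {ρ ρ' : E3 → ℝ}

theorem monotone_radialPotential (hρ : IsRadialDensity ρ) : Monotone (radialPotential ρ) := by
  have hpi := Real.pi_pos
  intro r r' h
  rw [radialPotential, radialPotential, neg_le_neg_iff]
  refine integral_mono_ae (integrable_div_max hρ r') (integrable_div_max hρ r) ?_
  filter_upwards [hρ.nonneg, Measure.ae_ne volume (0 : E3)] with y hy hy0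
  have hy' : 0 < ‖y‖ := norm_pos_iff.2 hy0
  have : 0 < max r ‖y‖ := hy'.trans_le (le_max_right _ _)
  gcongr

theorem newtonPotential_ae_eq (hρ : IsRadialDensity ρ) :
    newtonPotential ρ =ᵐ[volume] fun x => radialPotential ρ ‖x‖ := by
  filter_upwards [Measure.ae_ne volume (0 : E3)] with x hx
  exact newtonPotential_eq_radialPotential hρ hx

/-- Write both enclosed masses as integrals of indicators and apply Tonelli. For fixed `y, z` the
condition on `x` is `‖x‖ > max ‖z‖ ‖y‖`, and the exterior energy of that ball is exactly the radial
Newton kernel. This replaces integration by parts. -/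
theorem lintegral_field_product {d d' : E3 → ℝ≥0∞} (hd : Measurable d) (hd' : Measurable d') :
    ∫⁻ x : E3, (∫⁻ y in {y : E3 | ‖y‖ < ‖x‖}, d y) * (∫⁻ z in {z : E3 | ‖z‖ < ‖x‖}, d' z)
        * ENNReal.ofReal (1 / (4 * Real.pi * ‖x‖ ^ 2) ^ 2)
      = ∫⁻ z : E3, (∫⁻ y, d y * ENNReal.ofReal (1 / (4 * Real.pi * max ‖z‖ ‖y‖))) * d' z := by
  set I : E3 × E3 → ℝ≥0∞ := {p : E3 × E3 | ‖p.1‖ < ‖p.2‖}.indicator 1 with hI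
  have hIm : Measurable I := measurable_one.indicator
    (measurableSet_lt (by fun_prop) (by fun_prop))
  have hset : ∀ (b : E3 → ℝ≥0∞) (x : E3),
      ∫⁻ y in {y : E3 | ‖y‖ < ‖x‖}, b y = ∫⁻ y, b y * I (y, x) := by
    intro b x
    rw [← lintegral_indicator (measurableSet_lt (by fun_prop) (by fun_prop))]
    refine lintegral_congr fun y => ?_
    by_cases h : ‖y‖ < ‖x‖
    · rw [indicator_of_mem (by exact h), hI, indicator_of_mem (by exact h)]; simp
    · rw [indicator_of_notMem (by exact h), hI, indicator_of_notMem (by exact h)]; simp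
  simp_rw [hset]
  set K : E3 → ℝ≥0∞ := fun x => ENNReal.ofReal (1 / (4 * Real.pi * ‖x‖ ^ 2) ^ 2) with hK
  have hKm : Measurable K := by fun_prop
  have hm : Measurable fun x => ∫⁻ y, d y * I (y, x) :=
    Measurable.lintegral_prod_left' (f := fun p : E3 × E3 => d p.1 * I p) (by fun_prop)
  calc ∫⁻ x, (∫⁻ y, d y * I (y, x)) * (∫⁻ z, d' z * I (z, x)) * K x
      = ∫⁻ x, ∫⁻ z, (∫⁻ y, d y * I (y, x)) * K x * (d' z * I (z, x)) := by
        refine lintegral_congr fun x => ?_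
        rw [lintegral_const_mul _ (by fun_prop)]; ring
    _ = ∫⁻ z, ∫⁻ x, (∫⁻ y, d y * I (y, x)) * K x * (d' z * I (z, x)) := by
        rw [lintegral_lintegral_swap]
        exact Measurable.aemeasurable (by fun_prop)
    _ = ∫⁻ z, (∫⁻ y, d y * ENNReal.ofReal (1 / (4 * Real.pi * max ‖z‖ ‖y‖))) * d' z := by
        refine lintegral_congr_ae ?_
        filter_upwards [Measure.ae_ne volume (0 : E3)] with z hz
        have hz' : 0 < ‖z‖ := norm_pos_iff.2 hz
        calc ∫⁻ x, (∫⁻ y, d y * I (y, x)) * K x * (d' z * I (z, x))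
            = ∫⁻ x, (∫⁻ y, d y * (I (y, x) * I (z, x) * K x)) * d' z := by
              refine lintegral_congr fun x => ?_
              have e1 : ∀ y, d y * (I (y, x) * I (z, x) * K x)
                  = d y * I (y, x) * (I (z, x) * K x) := fun y => by ring
              simp_rw [e1]
              rw [lintegral_mul_const _ (by fun_prop)]; ring
          _ = (∫⁻ x, ∫⁻ y, d y * (I (y, x) * I (z, x) * K x)) * d' z := by
              rw [lintegral_mul_const]
              exact Measurable.lintegral_prod_left'
                (f := fun p : E3 × E3 => d p.1 * (I (p.1, p.2) * I (z, p.2) * K p.2)) (by fun_prop)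
          _ = (∫⁻ y, ∫⁻ x, d y * (I (y, x) * I (z, x) * K x)) * d' z := by
              rw [lintegral_lintegral_swap]
              exact Measurable.aemeasurable (by fun_prop)
          _ = _ := by
              congr 1
              refine lintegral_congr fun y => ?_
              rw [lintegral_const_mul _ (by fun_prop)]
              congr 1
              rw [← lintegral_outside_inv_pow_four (hz'.trans_le (le_max_left _ _))]
              refine lintegral_congr fun x => ?_
              by_cases h : max ‖z‖ ‖y‖ < ‖x‖
              · rw [indicator_of_mem (by exact h)]
                have h1 : I (y, x) = 1 :=
                  indicator_of_mem (s := {p : E3 × E3 | ‖p.1‖ < ‖p.2‖}) (a := (y, x))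
                    (show ‖y‖ < ‖x‖ from (le_max_right _ _).trans_lt h) _
                have h2 : I (z, x) = 1 :=
                  indicator_of_mem (s := {p : E3 × E3 | ‖p.1‖ < ‖p.2‖}) (a := (z, x))
                    (show ‖z‖ < ‖x‖ from (le_max_left _ _).trans_lt h) _
                rw [h1, h2, one_mul, one_mul]
              · rw [indicator_of_notMem (by exact h)]
                rw [max_lt_iff, not_and_or] at h
                rcases h with h | h
                · have h2 : I (z, x) = 0 := indicator_of_notMem (by exact h) _
                  rw [h2]; simp
                · have h2 : I (y, x) = 0 := indicator_of_notMem (by exact h) _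
                  rw [h2]; simp

theorem massInside_nonneg (hρ : IsRadialDensity ρ) (r : ℝ) : 0 ≤ massInside ρ r :=
  integral_nonneg_of_ae (ae_restrict_of_ae hρ.nonneg)

theorem gradient_newtonPotential (hρ : IsRadialDensity ρ) {x : E3} (hx : x ≠ 0) :
    gradient (newtonPotential ρ) x = (massInside ρ ‖x‖ / (4 * Real.pi * ‖x‖ ^ 3)) • x :=
  (hasGradientAt_newtonPotential hρ hx).gradient

theorem inner_gradient_newtonPotential (hρ : IsRadialDensity ρ) (hρ' : IsRadialDensity ρ')
    {x : E3} (hx : x ≠ 0) :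
    inner ℝ (gradient (newtonPotential ρ) x) (gradient (newtonPotential ρ') x)
      = massInside ρ ‖x‖ * massInside ρ' ‖x‖ * (1 / (4 * Real.pi * ‖x‖ ^ 2) ^ 2) := by
  have hx' : ‖x‖ ≠ 0 := norm_ne_zero_iff.2 hx
  have hpi := Real.pi_pos
  rw [gradient_newtonPotential hρ hx, gradient_newtonPotential hρ' hx, real_inner_smul_left,
    real_inner_smul_right, real_inner_self_eq_norm_sq]
  field_simp

/-- Both fields are nonnegative multiples of `x`, so their inner product is nonnegative and nothing
is lost by `ENNReal.ofReal`. -/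
theorem lintegral_inner_gradient (hρ : IsRadialDensity ρ) (hρ' : IsRadialDensity ρ') :
    ∫⁻ x, ENNReal.ofReal
        (inner ℝ (gradient (newtonPotential ρ) x) (gradient (newtonPotential ρ') x))
      = ∫⁻ z, ENNReal.ofReal (-newtonPotential ρ z * ρ' z) := by
  have hpi := Real.pi_pos
  obtain ⟨R, hR, hρR⟩ := hρ.radial
  obtain ⟨R', hR', hρR'⟩ := hρ'.radial
  have hmass : ∀ {σ : E3 → ℝ} {S : ℝ → ℝ}, IsRadialDensity σ → (∀ᵐ y, σ y = S ‖y‖) → ∀ r,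
      ENNReal.ofReal (massInside σ r) = ∫⁻ y in {y : E3 | ‖y‖ < r}, ENNReal.ofReal (S ‖y‖) := by
    intro σ S hσ hS r
    rw [massInside, ofReal_integral_eq_lintegral_ofReal hσ.integrable.integrableOn
      (ae_restrict_of_ae hσ.nonneg)]
    refine lintegral_congr_ae (ae_restrict_of_ae ?_)
    filter_upwards [hS] with y hy
    rw [hy]
  have h := lintegral_field_product (d := fun y => ENNReal.ofReal (R ‖y‖))
    (d' := fun y => ENNReal.ofReal (R' ‖y‖)) (by fun_prop) (by fun_prop)
  refine Eq.trans ?_ (h.trans ?_)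
  · refine lintegral_congr_ae ?_
    filter_upwards [Measure.ae_ne volume (0 : E3)] with x hx
    rw [inner_gradient_newtonPotential hρ hρ' hx, ENNReal.ofReal_mul (mul_nonneg
      (massInside_nonneg hρ _) (massInside_nonneg hρ' _)),
      ENNReal.ofReal_mul (massInside_nonneg hρ _), hmass hρ hρR, hmass hρ' hρR']
  · refine lintegral_congr_ae ?_
    filter_upwards [Measure.ae_ne volume (0 : E3), hρR'] with z hz hzR
    rw [newtonPotential_eq_radialPotential hρ hz, ENNReal.ofReal_mul
      (neg_nonneg.2 (radialPotential_nonpos hρ _)), hzR, radialPotential, neg_neg,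
      ofReal_integral_eq_lintegral_ofReal (integrable_div_max hρ _)]
    · congr 1
      refine lintegral_congr_ae ?_
      filter_upwards [hρR, hρ.nonneg] with y hy hy0
      rw [← ENNReal.ofReal_mul (by rwa [← hy]), hy, mul_one_div]
    · filter_upwards [hρ.nonneg] with y hy
      have : 0 ≤ max ‖z‖ ‖y‖ := (norm_nonneg y).trans (le_max_right _ _)
      simp only [Pi.zero_apply]
      positivity

theorem newtonPotential_bounds (hρ : IsRadialDensity ρ) {x : E3} (hx : x ≠ 0) :
    -((4 * Real.pi)⁻¹ * ∫ y, ρ y / ‖y‖) ≤ newtonPotential ρ x ∧ newtonPotential ρ x ≤ 0 := by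
  rw [newtonPotential_eq_radialPotential hρ hx]
  exact ⟨radialPotential_ge_const hρ _, radialPotential_nonpos hρ _⟩

theorem aestronglyMeasurable_newtonPotential (hρ : IsRadialDensity ρ) :
    AEStronglyMeasurable (newtonPotential ρ) :=
  (((monotone_radialPotential hρ).measurable.comp measurable_norm).aestronglyMeasurable).congr
    (newtonPotential_ae_eq hρ).symm

theorem integrable_newtonPotential_mul (hρ : IsRadialDensity ρ) (hρ' : IsRadialDensity ρ') :
    Integrable fun z => newtonPotential ρ z * ρ' z := by
  refine hρ'.integrable.bdd_mul (c := (4 * Real.pi)⁻¹ * ∫ y, ρ y / ‖y‖)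
    (aestronglyMeasurable_newtonPotential hρ) ?_
  filter_upwards [Measure.ae_ne volume (0 : E3)] with x hx
  have := newtonPotential_bounds hρ hx
  rw [Real.norm_eq_abs, abs_of_nonpos this.2]
  linarith

theorem measurable_gradient (φ : E3 → ℝ) : Measurable (gradient φ) := by
  unfold gradient
  exact (LinearIsometryEquiv.continuous _).measurable.comp (measurable_fderiv ℝ φ)

/-- The energy equals `-∫φρ`, which is finite because `φ` is bounded and `ρ` integrable. -/
theorem memLp_gradient_newtonPotential (hρ : IsRadialDensity ρ) :
    MemLp (gradient (newtonPotential ρ)) 2 := by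
  rw [memLp_two_iff_integrable_sq_norm (measurable_gradient _).aestronglyMeasurable]
  refine ⟨((measurable_gradient _).norm.pow_const 2).aestronglyMeasurable, ?_⟩
  rw [hasFiniteIntegral_iff_ofReal (Eventually.of_forall fun x => by positivity)]
  have h := lintegral_inner_gradient hρ hρ
  simp only [real_inner_self_eq_norm_sq] at h
  rw [h]
  have hi := (integrable_newtonPotential_mul hρ hρ).neg
  have := hi.lintegral_lt_top
  simpa [neg_mul] using this

theorem integral_inner_gradient (hρ : IsRadialDensity ρ) (hρ' : IsRadialDensity ρ') :
    ∫ x, inner ℝ (gradient (newtonPotential ρ) x) (gradient (newtonPotential ρ') x)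
      = -∫ z, newtonPotential ρ z * ρ' z := by
  rw [← integral_neg, integral_eq_lintegral_of_nonneg_ae, lintegral_inner_gradient hρ hρ',
    integral_eq_lintegral_of_nonneg_ae]
  · simp_rw [neg_mul]
  · filter_upwards [Measure.ae_ne volume (0 : E3), hρ'.nonneg] with z hz hz0
    have := newtonPotential_bounds hρ hz
    simp only [Pi.zero_apply]
    rw [← neg_mul]
    exact mul_nonneg (neg_nonneg.2 this.2) hz0
  · exact (integrable_newtonPotential_mul hρ hρ').neg.aestronglyMeasurable
  · filter_upwards [Measure.ae_ne volume (0 : E3)] with x hx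
    rw [inner_gradient_newtonPotential hρ hρ' hx]
    have := massInside_nonneg hρ ‖x‖
    have := massInside_nonneg hρ' ‖x‖
    simp only [Pi.zero_apply]
    positivity
  · exact ((measurable_gradient _).inner (measurable_gradient _)).aestronglyMeasurable

theorem hasFiniteFieldEnergy_newtonPotential (hρ : IsRadialDensity ρ) :
    HasFiniteFieldEnergy (newtonPotential ρ) :=
  ⟨fun _ hx => (hasGradientAt_newtonPotential hρ hx).differentiableAt,
    memLp_gradient_newtonPotential hρ⟩

theorem integral_norm_gradient_sub_sq (hρ : IsRadialDensity ρ) (hρ' : IsRadialDensity ρ') :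
    ∫ x, ‖gradient (newtonPotential ρ) x - gradient (newtonPotential ρ') x‖ ^ 2
      = (∫ x, ‖gradient (newtonPotential ρ) x‖ ^ 2)
        + (∫ x, ‖gradient (newtonPotential ρ') x‖ ^ 2)
        + 2 * ∫ z, newtonPotential ρ z * ρ' z := by
  have h1 := memLp_gradient_newtonPotential hρ
  have h2 := memLp_gradient_newtonPotential hρ'
  have i1 : Integrable fun x => ‖gradient (newtonPotential ρ) x‖ ^ 2 :=
    h1.integrable_norm_pow (by norm_num)
  have i2 : Integrable fun x => ‖gradient (newtonPotential ρ') x‖ ^ 2 :=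
    h2.integrable_norm_pow (by norm_num)
  have i3 : Integrable fun x =>
      inner ℝ (gradient (newtonPotential ρ) x) (gradient (newtonPotential ρ') x) :=
    (i1.add i2).mono'
      ((measurable_gradient _).inner (measurable_gradient _)).aestronglyMeasurable
      (Eventually.of_forall fun x => (norm_inner_le_norm _ _).trans (by
        simp only [Pi.add_apply]
        nlinarith [sq_nonneg (‖gradient (newtonPotential ρ) x‖ - ‖gradient (newtonPotential ρ') x‖),
          sq_nonneg (‖gradient (newtonPotential ρ) x‖ + ‖gradient (newtonPotential ρ') x‖)]))
  simp_rw [norm_sub_sq_real]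
  have i4 : Integrable fun x => ‖gradient (newtonPotential ρ) x‖ ^ 2
      - 2 * inner ℝ (gradient (newtonPotential ρ) x) (gradient (newtonPotential ρ') x) :=
    i1.sub (i3.const_mul 2)
  rw [integral_add i4 i2, integral_sub i1 (i3.const_mul 2),
    integral_const_mul, integral_inner_gradient hρ hρ']
  ring

theorem integral_norm_gradient_sq (hρ : IsRadialDensity ρ) :
    ∫ x, ‖gradient (newtonPotential ρ) x‖ ^ 2 = -∫ z, newtonPotential ρ z * ρ z := by
  rw [← integral_inner_gradient hρ hρ]
  simp_rw [real_inner_self_eq_norm_sq]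

end

/-! ### The bathtub principle on an abstract measure space. -/

section

section Rearrangement

variable {X : Type*} [MeasurableSpace X] {ν : Measure X} {E : X → ℝ}

/-- The bound states whose sublevel set has measure less than `m`. -/
def sublevelOfMass (ν : Measure X) (E : X → ℝ) (m : ℝ≥0∞) : Set X :=
  {x | E x < 0 ∧ ν {y | E y < E x} < m}

theorem subset_sublevelOfMass {m : ℝ≥0∞} {e : ℝ} (he : e ≤ 0) (hm : ν {y | E y < e} < m) :
    {x | E x < e} ⊆ sublevelOfMass ν E m := fun x hx =>
  ⟨lt_of_lt_of_le hx he,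
    (measure_mono fun y (hy : E y < E x) => show E y < e from lt_trans hy hx).trans_lt hm⟩

/-- Let energies increase to the supremum of those admissible. Points missed by the union sit at the
supremum itself, and level sets of `E` are null. -/
theorem sublevelOfMass_exhaustion (hnull : ∀ e, ν {x | E x = e} = 0) (m : ℝ≥0∞) :
    sublevelOfMass ν E m = ∅ ∨ ∃ u : ℕ → ℝ, Monotone u ∧
      (∀ n, u n < 0 ∧ ν {x | E x < u n} < m) ∧
      ν (sublevelOfMass ν E m \ ⋃ n, {x | E x < u n}) = 0 := by
  set S : Set ℝ := {e | e < 0 ∧ ν {y | E y < e} < m} with hS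
  rcases S.eq_empty_or_nonempty with h | h
  · left
    refine eq_empty_of_forall_notMem fun x hx => ?_
    have : E x ∈ S := hx
    rw [h] at this
    exact this
  · right
    have hb : BddAbove S := ⟨0, fun e he => he.1.le⟩
    obtain ⟨u, hum, -, hut, huS⟩ := (isLUB_csSup h hb).exists_seq_monotone_tendsto h
    refine ⟨u, hum, huS, ?_⟩
    refine measure_mono_null ?_ (hnull (sSup S))
    intro x hx
    have hxS : E x ∈ S := hx.1
    refine le_antisymm (le_csSup hb hxS) ?_
    by_contra hlt
    rw [not_le] at hlt
    obtain ⟨n, hn⟩ := (hut.eventually (lt_mem_nhds hlt)).exists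
    exact hx.2 (mem_iUnion.2 ⟨n, hn⟩)

/-- Continuity from below along the exhaustion. Equality can fail: the bound states may have total
mass less than `m`. -/
theorem measure_sublevelOfMass_le (hnull : ∀ e, ν {x | E x = e} = 0) (m : ℝ≥0∞) :
    ν (sublevelOfMass ν E m) ≤ m := by
  rcases sublevelOfMass_exhaustion hnull m with h | ⟨u, hum, huS, hu⟩
  · simp [h]
  · calc ν (sublevelOfMass ν E m) ≤ ν (⋃ n, {x | E x < u n}) := by
          refine measure_mono_ae ?_
          rw [ae_le_set]; exact hu
      _ = ⨆ n, ν {x | E x < u n} := by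
          refine Monotone.measure_iUnion fun i j hij x hx => ?_
          exact lt_of_lt_of_le hx (hum hij)
      _ ≤ m := iSup_le fun n => (huS n).2.le

/-- The bathtub estimate: filling the lowest energies first captures as much of `{E < e}` as a mass
budget `m` allows. -/
theorem le_measure_sublevelOfMass_inter (hE : Measurable E) (hnull : ∀ e, ν {x | E x = e} = 0)
    (hfin : ∀ e < 0, ν {x | E x < e} < ⊤) (hbot : ∃ c < 0, ν {x | E x < c} = 0)
    (m : ℝ≥0∞) {e : ℝ} (he : e < 0) :
    min m (ν {x | E x < e}) ≤ ν (sublevelOfMass ν E m ∩ {x | E x < e}) := by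
  rcases lt_or_ge (ν {x | E x < e}) m with h | h
  · rw [inter_eq_self_of_subset_right (subset_sublevelOfMass he.le h)]
    exact min_le_right _ _
  rcases eq_or_ne m 0 with rfl | hm
  · simp
  rw [min_eq_left h]
  set S : Set ℝ := {e | e < 0 ∧ ν {y | E y < e} < m} with hS
  have hne : S.Nonempty := by
    obtain ⟨c, hc, hc0⟩ := hbot
    exact ⟨c, hc, by rw [hc0]; exact pos_iff_ne_zero.2 hm⟩
  have hub : ∀ e' ∈ S, e' ≤ e := by
    intro e' he'
    by_contra hlt
    rw [not_le] at hlt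
    exact absurd he'.2 (not_lt.2 (h.trans (measure_mono fun _ hy => lt_trans hy hlt)))
  have hb : BddAbove S := ⟨e, hub⟩
  set x := sSup S with hx
  have hxe : x ≤ e := csSup_le hne hub
  -- Levels just above the critical energy `x` already carry mass at least `m`; continuity from
  -- above passes this to `{E ≤ x}`, and the level set `{E = x}` is null.
  have key : m ≤ ν {y | E y < x} := by
    rcases hxe.eq_or_lt with h' | h'
    · rw [h']; exact h
    have e1 : {y | E y ≤ x} = ⋂ n : ℕ, {y | E y < x + (e - x) / (n + 1)} := by
      ext y
      simp only [mem_ofPred_eq, mem_iInter]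
      constructor
      · intro hy n
        have : 0 < (e - x) / (n + 1) := div_pos (sub_pos.2 h') (by positivity)
        linarith
      · intro hy
        have ht : Tendsto (fun n : ℕ => x + (e - x) * (1 / ((n : ℝ) + 1))) atTop
            (𝓝 (x + (e - x) * 0)) :=
          (tendsto_one_div_add_atTop_nhds_zero_nat.const_mul _).const_add _
        have := ge_of_tendsto' ht (fun n => by
          have := (hy n).le; rwa [div_eq_mul_one_div] at this)
        simpa using this
    have e2 : ν {y | E y ≤ x} = ν {y | E y < x} := by
      refine le_antisymm ?_ (measure_mono fun y (hy : E y < x) => hy.le)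
      calc ν {y | E y ≤ x} ≤ ν ({y | E y < x} ∪ {y | E y = x}) :=
            measure_mono fun y (hy : E y ≤ x) =>
              show E y < x ∨ E y = x from lt_or_eq_of_le hy
        _ ≤ _ := (measure_union_le _ _).trans (by rw [hnull, add_zero])
    rw [← e2, e1, Antitone.measure_iInter]
    · refine le_iInf fun n => ?_
      rcases lt_or_ge (x + (e - x) / (n + 1)) 0 with h0 | h0
      · by_contra hlt
        rw [not_le] at hlt
        have := le_csSup hb (show x + (e - x) / (n + 1) ∈ S from ⟨h0, hlt⟩)
        have : 0 < (e - x) / (n + 1) := div_pos (sub_pos.2 h') (by positivity)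
        linarith
      · exact h.trans (measure_mono fun y hy => lt_of_lt_of_le hy (he.le.trans h0))
    · intro i j hij y hy
      refine lt_of_lt_of_le (show E y < _ from hy) ?_
      have : (e - x) / ((j : ℝ) + 1) ≤ (e - x) / ((i : ℝ) + 1) :=
        div_le_div_of_nonneg_left (sub_pos.2 h').le (by positivity)
          (by have : (i : ℝ) ≤ j := by exact_mod_cast hij
              linarith)
      linarith
    · intro n
      exact (measurableSet_lt hE measurable_const).nullMeasurableSet
    -- At index `0` the level is `e` itself, whose sublevel set has the finite measure that
    -- continuity from above requires.
    · refine ⟨0, ?_⟩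
      have : x + (e - x) / ((0 : ℕ) + 1) = e := by simp
      rw [this]
      exact (hfin e he).ne
  refine key.trans (measure_mono fun y hy => ?_)
  obtain ⟨e', he', hlt⟩ := exists_lt_of_lt_csSup hne hy
  exact ⟨subset_sublevelOfMass he'.1.le he'.2 hlt, lt_of_lt_of_le hy hxe⟩

theorem lintegral_ofReal_eq_lintegral_superlevel (ν : Measure X) {Φ : X → ℝ} (hΦ : Measurable Φ) :
    ∫⁻ x, ENNReal.ofReal (Φ x) ∂ν = ∫⁻ s in Ioi (0 : ℝ), ν {x | s < Φ x} := by
  have h := lintegral_eq_lintegral_meas_lt ν (f := fun x => max (Φ x) 0)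
    (Eventually.of_forall fun x => le_max_right _ _) (by fun_prop)
  have e1 : ∀ x, ENNReal.ofReal (max (Φ x) 0) = ENNReal.ofReal (Φ x) := by
    intro x; rw [ENNReal.ofReal, Real.toNNReal, ENNReal.ofReal, Real.toNNReal]; congr 1; ext; simp
  simp_rw [e1] at h
  rw [h]
  refine setLIntegral_congr_fun measurableSet_Ioi fun s hs => ?_
  have hs' : (0 : ℝ) < s := hs
  congr 1
  ext x
  simp [not_lt.2 hs'.le]

/-- Layer cake twice: for `Φ` under the measure of density `(-E)₊`, then for `-E` on each superlevel
set. The comparison of integrals becomes one of sets at each pair of levels. -/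
theorem lintegral_binding_eq_lintegral_superlevel {Φ : X → ℝ} (hE : Measurable E)
    (hΦ : Measurable Φ) :
    ∫⁻ x, ENNReal.ofReal (-E x) * ENNReal.ofReal (Φ x) ∂ν
      = ∫⁻ s in Ioi (0 : ℝ), ∫⁻ t in Ioi (0 : ℝ), ν ({x | s < Φ x} ∩ {x | E x < -t}) := by
  have hE' : Measurable fun x => ENNReal.ofReal (-E x) := by fun_prop
  have h := lintegral_ofReal_eq_lintegral_superlevel
    (ν.withDensity fun x => ENNReal.ofReal (-E x)) hΦ
  rw [lintegral_withDensity_eq_lintegral_mul _ hE' (by fun_prop)] at h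
  refine h.trans (lintegral_congr fun s => ?_)
  have hs : MeasurableSet {x | s < Φ x} := measurableSet_lt measurable_const hΦ
  rw [withDensity_apply _ hs, lintegral_ofReal_eq_lintegral_superlevel _ (by fun_prop)]
  refine lintegral_congr fun t => ?_
  rw [Measure.restrict_apply (measurableSet_lt measurable_const (by fun_prop)), inter_comm]
  congr 2
  ext x
  simp only [mem_ofPred_eq]
  exact lt_neg

variable {Φ G : X → ℝ}

theorem lintegral_rearranged_le (hnull : ∀ e, ν {x | E x = e} = 0)
    (hΦ : Measurable Φ) (hG : Measurable G)
    (hlevel : ∀ s > 0, {x | s < G x} = sublevelOfMass ν E (ν {x | s < Φ x})) :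
    ∫⁻ x, ENNReal.ofReal (G x) ∂ν ≤ ∫⁻ x, ENNReal.ofReal (Φ x) ∂ν := by
  rw [lintegral_ofReal_eq_lintegral_superlevel ν hΦ, lintegral_ofReal_eq_lintegral_superlevel ν hG]
  refine setLIntegral_mono' measurableSet_Ioi fun s hs => ?_
  rw [hlevel s hs]
  exact measure_sublevelOfMass_le hnull _

theorem measure_superlevel_inter_le (hE : Measurable E) (hnull : ∀ e, ν {x | E x = e} = 0)
    (hfin : ∀ e < 0, ν {x | E x < e} < ⊤) (hbot : ∃ c < 0, ν {x | E x < c} = 0)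
    (hlevel : ∀ s > 0, {x | s < G x} = sublevelOfMass ν E (ν {x | s < Φ x}))
    {s t : ℝ} (hs : 0 < s) (ht : 0 < t) :
    ν ({x | s < Φ x} ∩ {x | E x < -t}) ≤ ν ({x | s < G x} ∩ {x | E x < -t}) := by
  rw [hlevel s hs]
  exact (le_min (measure_mono inter_subset_left) (measure_mono inter_subset_right)).trans
    (le_measure_sublevelOfMass_inter hE hnull hfin hbot _ (neg_neg_of_pos ht))

theorem lintegral_binding_le (hE : Measurable E) (hnull : ∀ e, ν {x | E x = e} = 0)
    (hfin : ∀ e < 0, ν {x | E x < e} < ⊤) (hbot : ∃ c < 0, ν {x | E x < c} = 0)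
    (hΦ : Measurable Φ) (hG : Measurable G)
    (hlevel : ∀ s > 0, {x | s < G x} = sublevelOfMass ν E (ν {x | s < Φ x})) :
    ∫⁻ x, ENNReal.ofReal (-E x) * ENNReal.ofReal (Φ x) ∂ν
      ≤ ∫⁻ x, ENNReal.ofReal (-E x) * ENNReal.ofReal (G x) ∂ν := by
  rw [lintegral_binding_eq_lintegral_superlevel hE hΦ,
    lintegral_binding_eq_lintegral_superlevel hE hG]
  refine setLIntegral_mono' measurableSet_Ioi fun s hs => ?_
  exact setLIntegral_mono' measurableSet_Ioi fun t ht =>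
    measure_superlevel_inter_le hE hnull hfin hbot hlevel hs ht

theorem exists_mem_Ioo_of_ae_Ioi {P : ℝ → Prop}
    (h : ∀ᵐ t ∂(volume.restrict (Ioi (0 : ℝ))), P t) {a b : ℝ} (ha : 0 ≤ a) (hab : a < b) :
    ∃ t ∈ Ioo a b, P t := by
  by_contra hcon
  push Not at hcon
  rw [ae_restrict_iff' measurableSet_Ioi] at h
  have h0 : volume (Ioo a b) = 0 := measure_mono_null
    (fun t ht => fun hP => hcon t ht (hP (lt_of_le_of_lt ha ht.1))) h
  rw [Real.volume_Ioo, ENNReal.ofReal_eq_zero] at h0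
  linarith

/-- Between `e - 1/(n+1)` and `e` there is a level `-t` at which equality holds; the union over `n`
recovers `{E < e}`. The hypothesis is symmetric in `A` and `B`, so both directions are available. -/
theorem measure_inter_le_of_ae_eq {A B : Set X}
    (heq : ∀ᵐ t ∂(volume.restrict (Ioi (0 : ℝ))), ν (A ∩ {x | E x < -t}) = ν (B ∩ {x | E x < -t}))
    {e : ℝ} (he : e ≤ 0) : ν (B ∩ {x | E x < e}) ≤ ν (A ∩ {x | E x < e}) := by
  have e1 : B ∩ {x | E x < e} = ⋃ n : ℕ, B ∩ {x | E x < e - 1 / ((n : ℝ) + 1)} := by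
    ext x
    simp only [mem_inter_iff, mem_ofPred_eq, mem_iUnion]
    constructor
    · rintro ⟨hx, hxe⟩
      obtain ⟨n, hn⟩ := exists_nat_one_div_lt (sub_pos.2 hxe)
      exact ⟨n, hx, by linarith⟩
    · rintro ⟨n, hx, hn⟩
      have : 0 < 1 / ((n : ℝ) + 1) := by positivity
      exact ⟨hx, by linarith⟩
  rw [e1, Monotone.measure_iUnion]
  · refine iSup_le fun n => ?_
    have hn : 0 < 1 / ((n : ℝ) + 1) := by positivity
    obtain ⟨t, ht, hteq⟩ := exists_mem_Ioo_of_ae_Ioi heq (a := -e) (b := -e + 1 / ((n : ℝ) + 1))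
      (by linarith) (by linarith)
    calc ν (B ∩ {x | E x < e - 1 / ((n : ℝ) + 1)}) ≤ ν (B ∩ {x | E x < -t}) :=
          measure_mono (inter_subset_inter_right _ fun x hx => by
            simp only [mem_ofPred_eq] at hx ⊢; linarith [ht.2])
      _ = ν (A ∩ {x | E x < -t}) := hteq.symm
      _ ≤ ν (A ∩ {x | E x < e}) :=
          measure_mono (inter_subset_inter_right _ fun x hx => by
            simp only [mem_ofPred_eq] at hx ⊢; linarith [ht.1])
  · intro i j hij
    refine inter_subset_inter_right _ fun x hx => ?_
    have := Nat.one_div_le_one_div (α := ℝ) hij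
    simp only [mem_ofPred_eq] at hx ⊢
    linarith

theorem superlevel_ae_eq_of_measure_inter_eq (hnull : ∀ e, ν {x | E x = e} = 0)
    (hfin : ∀ e < 0, ν {x | E x < e} < ⊤) {A : Set X} (hA : MeasurableSet A) (hAfin : ν A < ⊤)
    (hB : MeasurableSet (sublevelOfMass ν E (ν A)))
    (hApos : ∀ᵐ x ∂ν, x ∈ A → E x ≤ 0)
    (heq : ∀ᵐ t ∂(volume.restrict (Ioi (0 : ℝ))),
      ν (A ∩ {x | E x < -t}) = ν (sublevelOfMass ν E (ν A) ∩ {x | E x < -t})) :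
    A =ᵐ[ν] sublevelOfMass ν E (ν A) := by
  set B := sublevelOfMass ν E (ν A) with hBdef
  have hBfin : ν B < ⊤ := (measure_sublevelOfMass_le hnull _).trans_lt hAfin
  -- Up to a null set `B` is a union of sublevel sets `{E < u n}` of finite measure, and `A` fills
  -- each of them by equality of measures.
  have hBA : ν (B \ A) = 0 := by
    rcases sublevelOfMass_exhaustion hnull (ν A) with h | ⟨u, -, huS, hu⟩
    · rw [hBdef, h]; simp
    · have h1 : ∀ n, ν ({x | E x < u n} \ A) = 0 := by
        intro n
        have hsub := subset_sublevelOfMass (huS n).1.le (huS n).2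
        have h2 := measure_inter_le_of_ae_eq heq (huS n).1.le
        rw [inter_eq_self_of_subset_right hsub] at h2
        have h3 := measure_inter_add_sdiff (μ := ν) {x | E x < u n} hA
        rw [inter_comm] at h3
        have h4 : ν {x | E x < u n} + ν ({x | E x < u n} \ A) ≤ ν {x | E x < u n} + 0 := by
          rw [add_zero]
          calc _ ≤ ν (A ∩ {x | E x < u n}) + ν ({x | E x < u n} \ A) := by gcongr
            _ = _ := h3
        exact le_antisymm ((ENNReal.add_le_add_iff_left (hfin _ (huS n).1).ne).1 h4) (zero_le)
      refine measure_mono_null (t := (B \ ⋃ n, {x | E x < u n}) ∪ ⋃ n, ({x | E x < u n} \ A)) ?_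
        (measure_union_null hu (measure_iUnion_null h1))
      intro x hx
      by_cases hxu : x ∈ ⋃ n, {x | E x < u n}
      · obtain ⟨n, hn⟩ := mem_iUnion.1 hxu
        exact Or.inr (mem_iUnion.2 ⟨n, hn, hx.2⟩)
      · exact Or.inl ⟨hx.1, hxu⟩
  -- Almost all of `A` has negative energy, so the comparison at level `0` bounds its mass by that
  -- of `B`, which lies in `A` up to a null set and has finite measure.
  have hAB : ν (A \ B) = 0 := by
    have h3 := measure_inter_add_sdiff (μ := ν) (A ∩ {x | E x < 0}) hB
    have h5 : ν B ≤ ν (A ∩ B) := by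
      have := measure_inter_add_sdiff (μ := ν) B hA
      rw [hBA, add_zero, inter_comm] at this
      exact this.ge
    have hB0 : B ∩ {x | E x < 0} = B := inter_eq_self_of_subset_left fun x hx => hx.1
    have h6 : ν (A \ B) ≤ ν ((A ∩ {x | E x < 0}) \ B) := by
      refine measure_mono_ae ?_
      have hz : ∀ᵐ x ∂ν, E x ≠ 0 := by
        rw [ae_iff]; simpa using hnull 0
      filter_upwards [hApos, hz] with x hx hx0 hxA
      exact ⟨⟨hxA.1, lt_of_le_of_ne (hx hxA.1) hx0⟩, hxA.2⟩
    have h7 := measure_inter_le_of_ae_eq (heq.mono fun t ht => ht.symm) (le_refl (0 : ℝ))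
    have h8 : A ∩ {x | E x < 0} ∩ B = A ∩ B := by rw [inter_right_comm, inter_assoc, hB0]
    rw [hB0, ← h3, h8] at h7
    refine le_antisymm (h6.trans ?_) zero_le
    have h9 : ν (A ∩ B) + ν ((A ∩ {x | E x < 0}) \ B) ≤ ν (A ∩ B) + 0 := by
      rw [add_zero]; exact h7.trans h5
    exact (ENNReal.add_le_add_iff_left
      (measure_mono inter_subset_right |>.trans_lt hBfin).ne).1 h9
  exact eventuallyLE_antisymm_iff.2 ⟨ae_le_set.2 hAB, ae_le_set.2 hBA⟩

/-- Ordered integrands with equal finite integrals agree almost everywhere, first in `s`, then in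
`t`, so almost every pair of superlevel sets coincides. Binding energy does not see `{E > 0}`;
`hΦpos` rules out mass there. -/
theorem ae_eq_of_lintegral_binding_eq (hE : Measurable E) (hnull : ∀ e, ν {x | E x = e} = 0)
    (hfin : ∀ e < 0, ν {x | E x < e} < ⊤) (hbot : ∃ c < 0, ν {x | E x < c} = 0)
    (hΦ : Measurable Φ) (hG : Measurable G)
    (hlevel : ∀ s > 0, {x | s < G x} = sublevelOfMass ν E (ν {x | s < Φ x}))
    (hΦint : ∫⁻ x, ENNReal.ofReal (Φ x) ∂ν ≠ ⊤)
    (hΦpos : ∫⁻ x, ENNReal.ofReal (E x) * ENNReal.ofReal (Φ x) ∂ν = 0)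
    (hGint : ∫⁻ x, ENNReal.ofReal (-E x) * ENNReal.ofReal (G x) ∂ν ≠ ⊤)
    (heq : ∫⁻ x, ENNReal.ofReal (-E x) * ENNReal.ofReal (Φ x) ∂ν
      = ∫⁻ x, ENNReal.ofReal (-E x) * ENNReal.ofReal (G x) ∂ν) :
    ∀ᵐ x ∂ν, ENNReal.ofReal (Φ x) = ENNReal.ofReal (G x) := by
  have hpos : ∀ᵐ x ∂ν, 0 < Φ x → E x ≤ 0 := by
    rw [lintegral_eq_zero_iff (by fun_prop)] at hΦpos
    filter_upwards [hΦpos] with x hx hx0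
    rcases mul_eq_zero.1 hx with h | h
    · exact ENNReal.ofReal_eq_zero.1 h
    · exact absurd (ENNReal.ofReal_eq_zero.1 h) (not_le.2 hx0)
  -- Monotonicity in the level supplies measurability, so `ν` need not be s-finite.
  have hanti : ∀ H : X → ℝ, Measurable fun s : ℝ =>
      ∫⁻ t in Ioi (0 : ℝ), ν ({x | s < H x} ∩ {x | E x < -t}) := fun H =>
    Antitone.measurable fun s s' hs => lintegral_mono fun t =>
      measure_mono (inter_subset_inter_left _ fun x (hx : s' < H x) => lt_of_le_of_lt hs hx)
  have hanti' : ∀ s : ℝ, ∀ H : X → ℝ, Measurable fun t : ℝ =>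
      ν ({x | s < H x} ∩ {x | E x < -t}) := fun s H =>
    Antitone.measurable fun t t' ht =>
      measure_mono (inter_subset_inter_right _ fun x (hx : E x < -t') =>
        lt_of_lt_of_le hx (neg_le_neg ht))
  rw [lintegral_binding_eq_lintegral_superlevel hE hΦ,
    lintegral_binding_eq_lintegral_superlevel hE hG] at heq
  rw [lintegral_binding_eq_lintegral_superlevel hE hG] at hGint
  rw [lintegral_ofReal_eq_lintegral_superlevel ν hΦ] at hΦint
  have hle : ∀ s > 0, ∀ t > 0, ν ({x | s < Φ x} ∩ {x | E x < -t})
      ≤ ν ({x | s < G x} ∩ {x | E x < -t}) := fun s hs t ht =>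
    measure_superlevel_inter_le hE hnull hfin hbot hlevel hs ht
  have hs_eq := ae_eq_of_ae_le_of_lintegral_le
    ((ae_restrict_iff' measurableSet_Ioi).2 (Eventually.of_forall fun s hs =>
      setLIntegral_mono' measurableSet_Ioi fun t ht => hle s hs t ht))
    (by rw [heq]; exact hGint) (hanti G).aemeasurable heq.ge
  have hs_fin := ae_lt_top (hanti G) hGint
  have hmass : ∀ᵐ s ∂(volume.restrict (Ioi (0 : ℝ))), ν {x | s < Φ x} < ⊤ :=
    ae_lt_top (Antitone.measurable fun s s' hs =>
      measure_mono fun x (hx : s' < Φ x) => lt_of_le_of_lt hs hx) hΦint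
  have hlev : ∀ᵐ s ∂(volume.restrict (Ioi (0 : ℝ))), ∀ᵐ x ∂ν, (s < Φ x ↔ s < G x) := by
    filter_upwards [hs_eq, hs_fin, hmass, ae_restrict_mem measurableSet_Ioi]
      with s h1 h2 h3 hs
    have hs' : (0 : ℝ) < s := hs
    have ht_eq := ae_eq_of_ae_le_of_lintegral_le
      ((ae_restrict_iff' measurableSet_Ioi).2 (Eventually.of_forall fun t ht => hle s hs' t ht))
      (by rw [h1]; exact h2.ne) (hanti' s G).aemeasurable h1.ge
    have hG' : MeasurableSet {x | s < G x} := measurableSet_lt measurable_const hG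
    have := superlevel_ae_eq_of_measure_inter_eq hnull hfin
      (measurableSet_lt measurable_const hΦ) h3 (by rwa [← hlevel s hs'])
      (hpos.mono fun x hx (hx' : s < Φ x) => hx (hs'.trans hx'))
      (by filter_upwards [ht_eq] with t ht; rw [ht, hlevel s hs'])
    rw [← hlevel s hs'] at this
    exact this.mem_iff
  -- One good level between each pair of rationals gives a countable family: its null sets can be
  -- united, and it still separates values.
  have hrat : ∀ q q' : ℚ, 0 ≤ q → q < q' → ∃ s ∈ Ioo (q : ℝ) q',
      ∀ᵐ x ∂ν, (s < Φ x ↔ s < G x) := fun q q' hq hqq' =>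
    exists_mem_Ioo_of_ae_Ioi hlev (by exact_mod_cast hq) (by exact_mod_cast hqq')
  choose! σ hσ hσ' using hrat
  have hall : ∀ᵐ x ∂ν, ∀ q q' : ℚ, 0 ≤ q → q < q' → (σ q q' < Φ x ↔ σ q q' < G x) := by
    simp only [ae_all_iff]
    exact hσ'
  filter_upwards [hall] with x hx
  have key : ∀ a b : ℝ, (∀ q q' : ℚ, 0 ≤ q → q < q' → (σ q q' < a ↔ σ q q' < b)) →
      ENNReal.ofReal a ≤ ENNReal.ofReal b := by
    intro a b hab
    by_contra hlt
    rw [not_le, ENNReal.ofReal_lt_ofReal_iff'] at hlt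
    obtain ⟨q, hq1, hq2⟩ := exists_rat_btwn (max_lt hlt.1 hlt.2)
    obtain ⟨q', hq1', hq2'⟩ := exists_rat_btwn hq2
    have hq0 : 0 ≤ q := by exact_mod_cast (le_max_right b 0).trans hq1.le
    have hqq' : q < q' := by exact_mod_cast hq1'
    have hm := hσ q q' hq0 hqq'
    have h1 := (hab q q' hq0 hqq').1 (hm.2.trans hq2')
    exact absurd (h1.trans_le (le_max_left b 0)) (not_lt.2 (hq1.le.trans hm.1.le))
  exact le_antisymm (key _ _ hx) (key _ _ fun q q' h h' => (hx q q' h h').symm)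

end Rearrangement

end

/-! ### Phase space in the coordinates `(ℓ, (r, w))`. -/

section

/-- Lagrange's identity. -/
theorem angularMomentumSq_eq (x v : E3) :
    angularMomentumSq x v = ‖x‖ ^ 2 * ‖v‖ ^ 2 - (inner ℝ x v) ^ 2 := by
  rw [angularMomentumSq, EuclideanSpace.norm_sq_eq, EuclideanSpace.norm_sq_eq,
    EuclideanSpace.norm_sq_eq, PiLp.inner_apply]
  simp [Fin.sum_univ_three, crossProduct]
  ring

/-- The measure `4π² dr dw` on `r > 0`, where `w` is the radial velocity. -/
def radialPhaseMeasure : Measure (ℝ × ℝ) :=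
  (ENNReal.ofReal (4 * Real.pi ^ 2) • volume.restrict (Ioi (0 : ℝ))).prod volume

instance instSFiniteRadialPhaseMeasure : SFinite radialPhaseMeasure := by unfold radialPhaseMeasure; infer_instance

/-- The coordinates `(ℓ, (r, w))`: squared angular momentum, radius and radial velocity. -/
def radialCoords (z : E3 × E3) : ℝ × (ℝ × ℝ) :=
  (angularMomentumSq z.1 z.2, (‖z.1‖, inner ℝ z.1 z.2 / ‖z.1‖))

/-- The image of Lebesgue measure on phase space under `radialCoords`. -/
def radialCoordsMeasure : Measure (ℝ × (ℝ × ℝ)) :=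
  (volume.restrict (Ioi (0 : ℝ))).prod radialPhaseMeasure

theorem measurable_angularMomentumSq :
    Measurable fun z : E3 × E3 => angularMomentumSq z.1 z.2 := by
  simp_rw [angularMomentumSq_eq]
  fun_prop

theorem measurable_radialCoords : Measurable radialCoords := by
  have := measurable_angularMomentumSq
  unfold radialCoords
  fun_prop

theorem lintegral_Ioi_comp_mul {c : ℝ} (hc : 0 < c) (h : ℝ → ℝ≥0∞) (hh : Measurable h) :
    ∫⁻ q in Ioi (0 : ℝ), h (c * q) = ENNReal.ofReal c⁻¹ * ∫⁻ l in Ioi (0 : ℝ), h l := by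
  have himg : (fun q => c * q) '' Ioi (0 : ℝ) = Ioi 0 := by
    rw [image_mul_left_Ioi hc, mul_zero]
  conv_rhs => rw [← himg]
  rw [lintegral_image_eq_lintegral_abs_deriv_mul (f' := fun _ => c) measurableSet_Ioi
    (fun t _ => by simpa using ((hasDerivAt_id t).const_mul c).hasDerivWithinAt)
    (fun a _ b _ hab => mul_left_cancel₀ hc.ne' hab), lintegral_const_mul _ (by fun_prop),
    abs_of_pos hc, ← mul_assoc, ← ENNReal.ofReal_mul (inv_nonneg.2 hc.le), inv_mul_cancel₀ hc.ne']
  simp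

/-- In axial coordinates of `v` along `x`, `w` is the axial component and `ℓ = r² q`, hence `dv = π
r⁻² dw dℓ`. The factor `r⁻²` cancels against `4πr² dr`. -/
theorem lintegral_radialCoords (h : ℝ × (ℝ × ℝ) → ℝ≥0∞) (hh : Measurable h) :
    ∫⁻ z, h (radialCoords z) = ∫⁻ y, h y ∂radialCoordsMeasure := by
  have hpi := Real.pi_pos
  have hrc := measurable_radialCoords
  rw [Measure.volume_eq_prod, lintegral_prod _ (by fun_prop)]
  have e1 : ∀ᵐ x : E3, ∫⁻ v, h (radialCoords (x, v)) = (fun r : ℝ => ∫⁻ p : ℝ,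
      ENNReal.ofReal (Real.pi * (r ^ 2)⁻¹) * ∫⁻ l in Ioi (0 : ℝ), h (l, (r, p))) ‖x‖ := by
    filter_upwards [Measure.ae_ne volume (0 : E3)] with x hx
    have hx' : 0 < ‖x‖ := norm_pos_iff.2 hx
    have hunit : ‖‖x‖⁻¹ • x‖ = 1 := by
      rw [norm_smul, norm_inv, norm_norm, inv_mul_cancel₀ hx'.ne']
    have e2 : ∀ v, h (radialCoords (x, v)) = (fun y : ℝ × ℝ => h (‖x‖ ^ 2 * y.2, (‖x‖, y.1)))
        (inner ℝ (‖x‖⁻¹ • x) v, ‖v‖ ^ 2 - (inner ℝ (‖x‖⁻¹ • x) v) ^ 2) := by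
      intro v
      simp only [radialCoords, angularMomentumSq_eq, real_inner_smul_left]
      congr 2
      · field_simp
      · rw [inv_mul_eq_div]
    rw [lintegral_congr e2, lintegral_axial _ hunit
      (fun y : ℝ × ℝ => h (‖x‖ ^ 2 * y.2, (‖x‖, y.1))) (by fun_prop)]
    refine lintegral_congr fun p => ?_
    rw [lintegral_const_mul _ (by fun_prop),
      lintegral_Ioi_comp_mul (by positivity : 0 < ‖x‖ ^ 2) (fun l => h (l, (‖x‖, p)))
      (by fun_prop), ← mul_assoc, ← ENNReal.ofReal_mul hpi.le]
  have hm1 : Measurable fun y : ℝ × ℝ => ∫⁻ l in Ioi (0 : ℝ), h (l, y) :=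
    Measurable.lintegral_prod_left' hh
  have hm2 : Measurable fun r : ℝ => ∫⁻ p : ℝ,
      ENNReal.ofReal (Real.pi * (r ^ 2)⁻¹) * ∫⁻ l in Ioi (0 : ℝ), h (l, (r, p)) :=
    Measurable.lintegral_prod_right' (f := fun y : ℝ × ℝ =>
      ENNReal.ofReal (Real.pi * (y.1 ^ 2)⁻¹) * ∫⁻ l in Ioi (0 : ℝ), h (l, y)) (by fun_prop)
  rw [lintegral_congr_ae e1, lintegral_radial _ hm2, radialCoordsMeasure,
    lintegral_prod_symm _ hh.aemeasurable, radialPhaseMeasure, lintegral_prod _ (by fun_prop),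
    lintegral_smul_measure, smul_eq_mul, ← lintegral_const_mul _
      (Measurable.lintegral_prod_right' (f := fun y : ℝ × ℝ => ∫⁻ l in Ioi (0 : ℝ), h (l, y)) hm1)]
  refine setLIntegral_congr_fun measurableSet_Ioi fun r hr => ?_
  have hr' : (0 : ℝ) < r := hr
  rw [lintegral_const_mul _ (by fun_prop), ← mul_assoc, ← ENNReal.ofReal_mul (by positivity)]
  congr 2
  field_simp

theorem measurePreserving_radialCoords :
    MeasurePreserving radialCoords volume radialCoordsMeasure := by
  refine ⟨measurable_radialCoords, Measure.ext_of_lintegral _ fun h hh => ?_⟩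
  rw [lintegral_map hh measurable_radialCoords, lintegral_radialCoords h hh]

/-- The radial velocity `w` as a function of `(r, u)` at fixed `ℓ`. -/
def radialVelocity (l r u : ℝ) : ℝ := Real.sign u * (Real.sqrt (r ^ 2 * u ^ 2 - l) / r)

section RadialVelocity

variable {l r u : ℝ}

theorem ne_zero_of_lt_sq (hl : 0 < l) (hu : l < r ^ 2 * u ^ 2) : u ≠ 0 := by
  rintro rfl
  norm_num at hu
  linarith

theorem radialVelocity_sq (hr : 0 < r) (hl : 0 < l) (hu : l < r ^ 2 * u ^ 2) :
    radialVelocity l r u ^ 2 + l / r ^ 2 = u ^ 2 := by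
  have h0 := ne_zero_of_lt_sq hl hu
  have h1 : Real.sign u ^ 2 = 1 := by
    rcases Real.sign_apply_eq_of_ne_zero u h0 with h | h <;> rw [h] <;> norm_num
  rw [radialVelocity, mul_pow, h1, div_pow, Real.sq_sqrt (by linarith)]
  field_simp
  ring

theorem image_radialVelocity (hr : 0 < r) (hl : 0 < l) :
    radialVelocity l r '' {u | l < r ^ 2 * u ^ 2} = {0}ᶜ := by
  ext w
  simp only [mem_image, mem_ofPred_eq, mem_compl_iff, mem_singleton_iff]
  constructor
  · rintro ⟨u, hu, rfl⟩
    have h0 := ne_zero_of_lt_sq hl hu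
    have h1 : 0 < Real.sqrt (r ^ 2 * u ^ 2 - l) := Real.sqrt_pos.2 (by linarith)
    have h2 : Real.sign u ≠ 0 := by
      rcases Real.sign_apply_eq_of_ne_zero u h0 with h | h <;> rw [h] <;> norm_num
    rw [radialVelocity]
    positivity
  · intro hw
    have hS : 0 < w ^ 2 + l / r ^ 2 := by positivity
    have hsq : r ^ 2 * (Real.sign w * Real.sqrt (w ^ 2 + l / r ^ 2)) ^ 2 = (r * w) ^ 2 + l := by
      have h1 : Real.sign w ^ 2 = 1 := by
        rcases Real.sign_apply_eq_of_ne_zero w hw with h | h <;> rw [h] <;> norm_num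
      rw [mul_pow, h1, Real.sq_sqrt hS.le]
      field_simp
    -- The inverse map: solve `u² = w² + ℓ/r²` with the sign of `w`.
    refine ⟨Real.sign w * Real.sqrt (w ^ 2 + l / r ^ 2), ?_, ?_⟩
    · rw [hsq]
      have : 0 < (r * w) ^ 2 := by positivity
      linarith
    · rw [radialVelocity, hsq, add_sub_cancel_right, Real.sqrt_sq_eq_abs, abs_mul, abs_of_pos hr,
        mul_div_cancel_left₀ _ hr.ne']
      have h3 := Real.sqrt_pos.2 hS
      rcases lt_or_gt_of_ne hw with h | h
      · rw [Real.sign_of_neg h, Real.sign_of_neg (by linarith), abs_of_neg h]; ring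
      · rw [Real.sign_of_pos h, Real.sign_of_pos (by linarith), abs_of_pos h]; ring

theorem sign_radialVelocity (hr : 0 < r) (hl : 0 < l) (hu : l < r ^ 2 * u ^ 2) :
    Real.sign (radialVelocity l r u) = Real.sign u := by
  have h0 := ne_zero_of_lt_sq hl hu
  have h1 : 0 < Real.sqrt (r ^ 2 * u ^ 2 - l) / r := div_pos (Real.sqrt_pos.2 (by linarith)) hr
  rw [radialVelocity]
  rcases lt_or_gt_of_ne h0 with h | h
  · rw [Real.sign_of_neg h, Real.sign_of_neg (by linarith)]
  · rw [Real.sign_of_pos h, Real.sign_of_pos (by linarith)]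

theorem injOn_radialVelocity (hr : 0 < r) (hl : 0 < l) :
    InjOn (radialVelocity l r) {u | l < r ^ 2 * u ^ 2} := by
  intro u hu u' hu' h
  have h1 : u ^ 2 = u' ^ 2 := by
    rw [← radialVelocity_sq hr hl hu, ← radialVelocity_sq hr hl hu', h]
  have h2 : Real.sign u = Real.sign u' := by
    rw [← sign_radialVelocity hr hl hu, ← sign_radialVelocity hr hl hu', h]
  have h0 := ne_zero_of_lt_sq hl hu
  rcases sq_eq_sq_iff_eq_or_eq_neg.1 h1 with h3 | h3
  · exact h3
  · exfalso
    rw [h3, Real.sign_neg] at h2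
    have h0' := ne_zero_of_lt_sq hl hu'
    rcases Real.sign_apply_eq_of_ne_zero u' h0' with h | h <;> rw [h] at h2 <;> norm_num at h2

/-- From `u² = w² + ℓ/r²` one has `u du = w dw`, so the derivative is the density of `nu` without
the factor `4π²`. -/
theorem hasDerivAt_radialVelocity (hr : 0 < r) (hl : 0 < l) (hu : l < r ^ 2 * u ^ 2) :
    HasDerivAt (radialVelocity l r) ((Real.sqrt (r ^ 2 * u ^ 2 - l))⁻¹ * r * |u|) u := by
  have h0 := ne_zero_of_lt_sq hl hu
  have hs : Real.sqrt (r ^ 2 * u ^ 2 - l) ≠ 0 := (Real.sqrt_pos.2 (by linarith)).ne'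
  have h1 : HasDerivAt (fun u => r ^ 2 * u ^ 2 - l) (r ^ 2 * (2 * u)) u := by
    simpa using ((hasDerivAt_pow 2 u).const_mul (r ^ 2)).sub_const l
  have h2 := (h1.sqrt (by linarith)).div_const r
  have hsign : Real.sign =ᶠ[𝓝 u] fun _ => Real.sign u := by
    rcases lt_or_gt_of_ne h0 with h | h
    · filter_upwards [gt_mem_nhds h] with t ht
      rw [Real.sign_of_neg ht, Real.sign_of_neg h]
    · filter_upwards [lt_mem_nhds h] with t ht
      rw [Real.sign_of_pos ht, Real.sign_of_pos h]
  refine ((h2.const_mul (Real.sign u)).congr_deriv ?_).congr_of_eventuallyEq ?_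
  · rcases lt_or_gt_of_ne h0 with h | h
    · rw [Real.sign_of_neg h, abs_of_neg h]; field_simp
    · rw [Real.sign_of_pos h, abs_of_pos h]; field_simp
  · filter_upwards [hsign] with t ht
    rw [radialVelocity, ht]

theorem lintegral_radialVelocity (hr : 0 < r) (hl : 0 < l) (h : ℝ → ℝ≥0∞) :
    ∫⁻ u in {u | l < r ^ 2 * u ^ 2}, ENNReal.ofReal ((Real.sqrt (r ^ 2 * u ^ 2 - l))⁻¹ * r * |u|)
      * h (radialVelocity l r u) = ∫⁻ w, h w := by
  have e1 : ∫⁻ w, h w = ∫⁻ w in radialVelocity l r '' {u | l < r ^ 2 * u ^ 2}, h w := by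
    rw [image_radialVelocity hr hl, Measure.restrict_eq_self_of_ae_mem]
    exact Measure.ae_ne volume 0
  have hS : MeasurableSet {u | l < r ^ 2 * u ^ 2} := measurableSet_lt (by fun_prop) (by fun_prop)
  rw [e1, lintegral_image_eq_lintegral_abs_deriv_mul hS
    (fun u hu => (hasDerivAt_radialVelocity hr hl hu).hasDerivWithinAt)
    (injOn_radialVelocity hr hl)]
  refine lintegral_congr fun u => ?_
  rw [abs_of_nonneg (by positivity : 0 ≤ (Real.sqrt (r ^ 2 * u ^ 2 - l))⁻¹ * r * |u|)]

end RadialVelocity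

theorem measurable_sign : Measurable Real.sign := by
  unfold Real.sign
  exact Measurable.ite measurableSet_Iio measurable_const
    (Measurable.ite measurableSet_Ioi measurable_const measurable_const)

theorem measurableSet_phaseDomain (l : ℝ) :
    MeasurableSet {p : ℝ × ℝ | 0 < p.1 ∧ l < p.1 ^ 2 * p.2 ^ 2} :=
  MeasurableSet.inter (s₁ := {p : ℝ × ℝ | 0 < p.1}) (s₂ := {p : ℝ × ℝ | l < p.1 ^ 2 * p.2 ^ 2})
    (measurableSet_lt (by fun_prop) (by fun_prop)) (measurableSet_lt (by fun_prop) (by fun_prop))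

/-- The change of variable `u ↦ w` at each `r` absorbs the singular density, leaving a measure that
no longer depends on `ℓ`. -/
theorem nu_preimage_radialVelocity {l : ℝ} (hl : 0 < l) {s : Set (ℝ × ℝ)} (hs : MeasurableSet s) :
    nu l {p | (p.1, radialVelocity l p.1 p.2) ∈ s} = radialPhaseMeasure s := by
  have hpi := Real.pi_pos
  have hsign := measurable_sign
  have hW : Measurable fun p : ℝ × ℝ => radialVelocity l p.1 p.2 := by
    unfold radialVelocity
    fun_prop
  have hS : MeasurableSet {p : ℝ × ℝ | (p.1, radialVelocity l p.1 p.2) ∈ s} :=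
    (measurable_fst.prodMk hW) hs
  have hD := measurableSet_phaseDomain l
  rw [nu, withDensity_apply _ hS, Measure.restrict_restrict hS,
    ← lintegral_indicator (hS.inter hD), Measure.volume_eq_prod, lintegral_prod _
    (Measurable.aemeasurable (Measurable.indicator (by fun_prop) (hS.inter hD))),
    radialPhaseMeasure, Measure.prod_apply hs, lintegral_smul_measure, smul_eq_mul,
    ← lintegral_const_mul _ (measurable_measure_prodMk_left hs),
    ← lintegral_indicator measurableSet_Ioi]
  refine lintegral_congr fun r => ?_
  by_cases hr : 0 < r
  · rw [indicator_of_mem (mem_Ioi.2 hr)]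
    have hsec : MeasurableSet (Prod.mk r ⁻¹' s) := measurable_prodMk_left hs
    rw [← lintegral_indicator_one hsec,
      ← lintegral_radialVelocity hr hl ((Prod.mk r ⁻¹' s).indicator 1),
      ← lintegral_const_mul' _ _ ENNReal.ofReal_ne_top,
      ← lintegral_indicator (measurableSet_lt (by fun_prop) (by fun_prop))]
    refine lintegral_congr fun u => ?_
    classical
    simp only [indicator_apply, mem_inter_iff, mem_ofPred_eq, mem_preimage, hr, true_and]
    by_cases hu : l < r ^ 2 * u ^ 2
    · by_cases hm : (r, radialVelocity l r u) ∈ s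
      · rw [if_pos ⟨hm, hu⟩, if_pos hu, if_pos hm, Pi.one_apply, mul_one,
          ← ENNReal.ofReal_mul (by positivity)]
        congr 1
        ring
      · rw [if_neg (fun h => hm h.1), if_pos hu, if_neg hm, mul_zero, mul_zero]
    · rw [if_neg (fun h => hu h.2), if_neg hu]
  · rw [indicator_of_notMem (by simpa using hr)]
    have : ∀ u, ({p : ℝ × ℝ | (p.1, radialVelocity l p.1 p.2) ∈ s} ∩
        {p : ℝ × ℝ | 0 < p.1 ∧ l < p.1 ^ 2 * p.2 ^ 2}).indicator (fun p => ENNReal.ofReal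
      (4 * Real.pi ^ 2 * (Real.sqrt (p.1 ^ 2 * p.2 ^ 2 - l))⁻¹ * p.1 * |p.2|)) (r, u) = 0 :=
      fun u => indicator_of_notMem (fun h => hr h.2.1) _
    simp_rw [this, lintegral_zero]

theorem ae_nu (l : ℝ) : ∀ᵐ p ∂(nu l), 0 < p.1 ∧ l < p.1 ^ 2 * p.2 ^ 2 := by
  have hD := measurableSet_phaseDomain l
  exact (withDensity_absolutelyContinuous _ _).ae_le (ae_restrict_mem hD)

/-- The profile in the coordinates `(ℓ, (r, w))`. -/
def phaseProfile (F : ℝ × ℝ × ℝ → ℝ) (l : ℝ) (y : ℝ × ℝ) : ℝ :=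
  F (y.1, Real.sqrt (y.2 ^ 2 + l / y.1 ^ 2), y.1 * y.2)

/-- The microscopic energy of the radial potential `V` in the coordinates `(ℓ, (r, w))`. -/
def phaseEnergy (V : ℝ → ℝ) (l : ℝ) (y : ℝ × ℝ) : ℝ := (y.2 ^ 2 + l / y.1 ^ 2) / 2 + V y.1

theorem distribution_eq {F : ℝ × ℝ × ℝ → ℝ} (hF : Measurable F) {l : ℝ} (hl : 0 < l) (s : ℝ) :
    distribution F s l = radialPhaseMeasure {y | s < phaseProfile F l y} := by
  have hm : MeasurableSet {y | s < phaseProfile F l y} := by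
    unfold phaseProfile
    exact measurableSet_lt measurable_const (by fun_prop)
  rw [distribution, ← nu_preimage_radialVelocity hl hm]
  refine measure_congr ?_
  filter_upwards [ae_nu l] with p hp
  have h1 := radialVelocity_sq hp.1 hl hp.2
  have h2 : p.1 * radialVelocity l p.1 p.2
      = Real.sign p.2 * Real.sqrt (p.1 ^ 2 * p.2 ^ 2 - l) := by
    rw [radialVelocity]
    have := hp.1.ne'
    field_simp
  have h3 : inRUL F p.1 p.2 l = phaseProfile F l (p.1, radialVelocity l p.1 p.2) := by
    rw [inRUL, phaseProfile, h2]
    simp only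
    rw [h1, Real.sqrt_sq_eq_abs]
  change (s < inRUL F p.1 p.2 l) = (s < phaseProfile F l (p.1, radialVelocity l p.1 p.2))
  rw [h3]

theorem jacobian_eq {φ : E3 → ℝ} {V : ℝ → ℝ} (hV : Measurable V)
    (hφ : ∀ r > 0, φ (EuclideanSpace.single 0 r) = V r) {l : ℝ} (hl : 0 < l) {e : ℝ}
    (he : e < 0) :
    jacobian φ e l = radialPhaseMeasure {y | phaseEnergy V l y < e} := by
  have hm : MeasurableSet {y | phaseEnergy V l y < e} := by
    unfold phaseEnergy
    exact measurableSet_lt (by fun_prop) measurable_const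
  rw [jacobian, if_pos he, ← nu_preimage_radialVelocity hl hm]
  refine measure_congr ?_
  filter_upwards [ae_nu l] with p hp
  have h1 := radialVelocity_sq hp.1 hl hp.2
  change (p.2 ^ 2 / 2 + φ (EuclideanSpace.single 0 p.1) < e)
    = (phaseEnergy V l (p.1, radialVelocity l p.1 p.2) < e)
  rw [phaseEnergy, hφ _ hp.1]
  simp only
  rw [h1]

end

/-! ### Finite-energy functions and the identity for the Hamiltonian. -/

section

variable {f : E3 × E3 → ℝ} {F : ℝ × ℝ × ℝ → ℝ}

/-- At radius `r` the velocity ball `|v| ≤ r^{-1/2}` has volume of order `r^{-3/2}`. With the factor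
`1/r` and the shell area `r²` this leaves `r^{-1/2}`, integrable at the origin. -/
theorem lintegral_div_norm_near_origin (K : ℝ) :
    ∫⁻ z : E3 × E3, {z : E3 × E3 | ‖z.1‖ < 1 ∧ ‖z.2‖ ^ 2 ≤ ‖z.1‖⁻¹}.indicator
      (fun z => ENNReal.ofReal (K * ‖z.1‖⁻¹)) z < ⊤ := by
  have hS : MeasurableSet {z : E3 × E3 | ‖z.1‖ < 1 ∧ ‖z.2‖ ^ 2 ≤ ‖z.1‖⁻¹} :=
    MeasurableSet.inter (s₁ := {z : E3 × E3 | ‖z.1‖ < 1})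
      (s₂ := {z : E3 × E3 | ‖z.2‖ ^ 2 ≤ ‖z.1‖⁻¹})
      (measurableSet_lt (by fun_prop) (by fun_prop)) (measurableSet_le (by fun_prop) (by fun_prop))
  rw [Measure.volume_eq_prod, lintegral_prod _
    (Measurable.aemeasurable (Measurable.indicator (by fun_prop) hS))]
  set B := volume (Metric.ball (0 : E3) 1) with hB
  have hBfin : B < ⊤ := measure_ball_lt_top
  have hle : ∀ x : E3, ∫⁻ v : E3, {z : E3 × E3 | ‖z.1‖ < 1 ∧ ‖z.2‖ ^ 2 ≤ ‖z.1‖⁻¹}.indicator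
      (fun z => ENNReal.ofReal (K * ‖z.1‖⁻¹)) (x, v)
      ≤ (Iio (1 : ℝ)).indicator (fun r => ENNReal.ofReal |K| * B *
        (ENNReal.ofReal r⁻¹ * ENNReal.ofReal (Real.sqrt r⁻¹ ^ 3))) ‖x‖ := by
    intro x
    by_cases hx : ‖x‖ < 1
    · rw [indicator_of_mem (mem_Iio.2 hx)]
      calc _ ≤ ∫⁻ v : E3, (Metric.closedBall (0 : E3) (Real.sqrt ‖x‖⁻¹)).indicator
            (fun _ => ENNReal.ofReal |K| * ENNReal.ofReal ‖x‖⁻¹) v := by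
            refine lintegral_mono fun v => ?_
            by_cases hv : ‖v‖ ^ 2 ≤ ‖x‖⁻¹
            · rw [indicator_of_mem (show (x, v) ∈ {z : E3 × E3 | ‖z.1‖ < 1 ∧ ‖z.2‖ ^ 2 ≤ ‖z.1‖⁻¹}
                from ⟨hx, hv⟩), indicator_of_mem (by
                  rw [mem_closedBall_zero_iff]; exact Real.le_sqrt_of_sq_le hv),
                ← ENNReal.ofReal_mul (abs_nonneg K)]
              refine ENNReal.ofReal_le_ofReal ?_
              have := le_abs_self K
              simp only
              gcongr
            · rw [indicator_of_notMem (fun h => hv h.2)]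
              exact zero_le
        _ = _ := by
            rw [lintegral_indicator_const measurableSet_closedBall,
              Measure.addHaar_closedBall _ _ (Real.sqrt_nonneg _)]
            simp only [finrank_euclideanSpace, Fintype.card_fin]
            ring
    · rw [indicator_of_notMem (by simpa using hx)]
      have : ∀ v : E3, {z : E3 × E3 | ‖z.1‖ < 1 ∧ ‖z.2‖ ^ 2 ≤ ‖z.1‖⁻¹}.indicator
        (fun z => ENNReal.ofReal (K * ‖z.1‖⁻¹)) (x, v) = 0 :=
        fun v => indicator_of_notMem (fun h => hx h.1) _
      simp_rw [this, lintegral_zero]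
      exact le_rfl
  refine (lintegral_mono hle).trans_lt ?_
  rw [lintegral_radial _ (Measurable.indicator (by fun_prop) measurableSet_Iio)]
  have hint : IntegrableOn (fun s : ℝ => s ^ (-(1 / 2) : ℝ)) (Ioo 0 1) := by
    rw [← intervalIntegrable_iff_integrableOn_Ioo_of_le zero_le_one]
    exact intervalIntegral.intervalIntegrable_rpow' (by norm_num)
  have hfin : ∫⁻ s in Ioo (0 : ℝ) 1, ENNReal.ofReal (s ^ (-(1 / 2) : ℝ)) < ⊤ := by
    have := hint.lintegral_lt_top
    exact this
  calc ∫⁻ s in Ioi (0 : ℝ), ENNReal.ofReal (4 * Real.pi * s ^ 2) * (Iio (1 : ℝ)).indicator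
        (fun r => ENNReal.ofReal |K| * B *
          (ENNReal.ofReal r⁻¹ * ENNReal.ofReal (Real.sqrt r⁻¹ ^ 3))) s
      = ∫⁻ s in Ioo (0 : ℝ) 1, ENNReal.ofReal (4 * Real.pi) * (ENNReal.ofReal |K| * B) *
          ENNReal.ofReal (s ^ (-(1 / 2) : ℝ)) := by
        rw [← lintegral_indicator measurableSet_Ioi, ← lintegral_indicator measurableSet_Ioo]
        refine lintegral_congr fun s => ?_
        by_cases h0 : 0 < s
        · rw [indicator_of_mem (mem_Ioi.2 h0)]
          by_cases h1 : s < 1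
          · rw [indicator_of_mem (mem_Iio.2 h1), indicator_of_mem (mem_Ioo.2 ⟨h0, h1⟩)]
            have e1 : ENNReal.ofReal (s ^ 2) * (ENNReal.ofReal s⁻¹ *
                ENNReal.ofReal (Real.sqrt s⁻¹ ^ 3)) = ENNReal.ofReal (s ^ (-(1 / 2) : ℝ)) := by
              rw [← ENNReal.ofReal_mul (by positivity), ← ENNReal.ofReal_mul (by positivity)]
              congr 1
              rw [Real.rpow_neg h0.le, ← Real.sqrt_eq_rpow, Real.sqrt_inv]
              have h2 := Real.sq_sqrt h0.le
              have h3 := Real.sqrt_pos.2 h0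
              set t := Real.sqrt s
              rw [← h2]
              field_simp
            rw [← e1, ENNReal.ofReal_mul (by positivity)]
            ring
          · rw [indicator_of_notMem (s := Iio 1) (by simpa using h1), mul_zero,
              indicator_of_notMem (fun h => h1 h.2)]
        · rw [indicator_of_notMem (by simpa using h0), indicator_of_notMem (fun h => h0 h.1)]
    _ < ⊤ := by
        rw [lintegral_const_mul' _ _ (by finiteness)]
        finiteness

theorem FiniteEnergy.exists_bound (hf : FiniteEnergy f) : ∃ K : ℝ, 0 ≤ K ∧ ∀ᵐ z, f z ≤ K := by
  have h := hf.essBounded.eLpNorm_lt_top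
  rw [eLpNorm_exponent_top] at h
  refine ⟨(eLpNormEssSup f volume).toReal, ENNReal.toReal_nonneg, ?_⟩
  filter_upwards [ae_le_eLpNormEssSup (f := f) (μ := volume)] with z hz
  have h2 := ENNReal.toReal_mono h.ne hz
  rw [toReal_enorm] at h2
  exact (le_abs_self _).trans h2

/-- Three regions: `f/|x| ≤ f` for `|x| ≥ 1`; `f/|x| ≤ |v|² f` where `|v|² > 1/|x|`; the essential
bound of `f` on the rest. This makes the potential bounded. -/
theorem FiniteEnergy.integrable_div_norm (hf : FiniteEnergy f) :
    Integrable fun z : E3 × E3 => f z / ‖z.1‖ := by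
  obtain ⟨K, hK, hfK⟩ := hf.exists_bound
  have hS : MeasurableSet {z : E3 × E3 | ‖z.1‖ < 1 ∧ ‖z.2‖ ^ 2 ≤ ‖z.1‖⁻¹} :=
    MeasurableSet.inter (s₁ := {z : E3 × E3 | ‖z.1‖ < 1})
      (s₂ := {z : E3 × E3 | ‖z.2‖ ^ 2 ≤ ‖z.1‖⁻¹})
      (measurableSet_lt (by fun_prop) (by fun_prop)) (measurableSet_le (by fun_prop) (by fun_prop))
  set b : E3 × E3 → ℝ := {z : E3 × E3 | ‖z.1‖ < 1 ∧ ‖z.2‖ ^ 2 ≤ ‖z.1‖⁻¹}.indicator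
      (fun z => K * ‖z.1‖⁻¹) with hb
  have hb0 : ∀ z, 0 ≤ b z := fun z => indicator_nonneg (fun z _ => by positivity) z
  have hbint : Integrable b := by
    refine ⟨(Measurable.indicator (by fun_prop) hS).aestronglyMeasurable, ?_⟩
    rw [hasFiniteIntegral_iff_ofReal (Eventually.of_forall hb0)]
    refine lt_of_eq_of_lt (lintegral_congr fun z => ?_) (lintegral_div_norm_near_origin K)
    by_cases hz : z ∈ {z : E3 × E3 | ‖z.1‖ < 1 ∧ ‖z.2‖ ^ 2 ≤ ‖z.1‖⁻¹}
    · rw [hb, indicator_of_mem hz, indicator_of_mem hz]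
    · rw [hb, indicator_of_notMem hz, indicator_of_notMem hz, ENNReal.ofReal_zero]
  refine ((hf.kinetic.add hf.integrable).add hbint).mono'
    (hf.integrable.aemeasurable.div (g := fun z => ‖z.1‖) (by fun_prop)).aestronglyMeasurable ?_
  filter_upwards [hf.nonneg, hfK] with z hz hzK
  have hz1 : 0 ≤ ‖z.1‖⁻¹ := by positivity
  rw [Real.norm_of_nonneg (by positivity)]
  simp only [Pi.add_apply]
  have hkin : 0 ≤ ‖z.2‖ ^ 2 * f z := by positivity
  have hbz := hb0 z
  rw [div_eq_mul_inv]
  by_cases h1 : ‖z.1‖ < 1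
  · by_cases h2 : ‖z.2‖ ^ 2 ≤ ‖z.1‖⁻¹
    · have : b z = K * ‖z.1‖⁻¹ := indicator_of_mem (show z ∈
        {z : E3 × E3 | ‖z.1‖ < 1 ∧ ‖z.2‖ ^ 2 ≤ ‖z.1‖⁻¹} from ⟨h1, h2⟩) _
      rw [this]
      nlinarith
    · rw [not_le] at h2
      nlinarith
  · have : ‖z.1‖⁻¹ ≤ 1 := inv_le_one_of_one_le₀ (not_lt.1 h1)
    nlinarith

theorem isRadialDensity_density (hf : FiniteEnergy f) (hF : IsRadialProfile F f) :
    IsRadialDensity (density f) := by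
  have hFm := hF.measurable
  have hfi : Integrable f (volume.prod volume) := hf.integrable
  refine ⟨?_, hfi.integral_prod_left, ?_, ?_⟩
  · filter_upwards [Measure.ae_ae_of_ae_prod hf.nonneg] with x hx
    exact integral_nonneg_of_ae hx
  · have h : Integrable (fun z : E3 × E3 => f z / ‖z.1‖) (volume.prod volume) :=
      hf.integrable_div_norm
    refine h.integral_prod_left.congr (Eventually.of_forall fun x => ?_)
    exact integral_div ‖x‖ fun v => f (x, v)
  -- The profile of the density is the velocity integral in axial coordinates along `x`; as an
  -- iterated `lintegral` it is measurable in `r`.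
  · refine ⟨fun r => (∫⁻ p : ℝ, ∫⁻ q in Ioi (0 : ℝ), ENNReal.ofReal Real.pi *
      ENNReal.ofReal (F (r, Real.sqrt (p ^ 2 + q), r * p))).toReal, ?_, ?_⟩
    · refine Measurable.ennreal_toReal ?_
      have h1 : Measurable fun y : ℝ × ℝ => ∫⁻ q in Ioi (0 : ℝ), ENNReal.ofReal Real.pi *
          ENNReal.ofReal (F (y.1, Real.sqrt (y.2 ^ 2 + q), y.1 * y.2)) :=
        Measurable.lintegral_prod_right' (f := fun t : (ℝ × ℝ) × ℝ => ENNReal.ofReal Real.pi *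
          ENNReal.ofReal (F (t.1.1, Real.sqrt (t.1.2 ^ 2 + t.2), t.1.1 * t.1.2))) (by fun_prop)
      exact Measurable.lintegral_prod_right' h1
    · filter_upwards [Measure.ae_ae_of_ae_prod hf.nonneg, Measure.ae_ae_of_ae_prod hF.ae_eq,
        hfi.prod_right_ae, Measure.ae_ne volume (0 : E3)] with x hx hxF hxi hx0
      have hx' : 0 < ‖x‖ := norm_pos_iff.2 hx0
      have hunit : ‖‖x‖⁻¹ • x‖ = 1 := by
        rw [norm_smul, norm_inv, norm_norm, inv_mul_cancel₀ hx'.ne']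
      rw [density, integral_eq_lintegral_of_nonneg_ae hx hxi.aestronglyMeasurable,
        ← lintegral_axial _ hunit (fun y : ℝ × ℝ =>
          ENNReal.ofReal (F (‖x‖, Real.sqrt (y.1 ^ 2 + y.2), ‖x‖ * y.1))) (by fun_prop)]
      congr 1
      refine lintegral_congr_ae ?_
      filter_upwards [hxF] with v hv
      rw [hv, add_sub_cancel, Real.sqrt_sq (norm_nonneg v), real_inner_smul_left,
        mul_inv_cancel_left₀ hx'.ne']

theorem poissonField_eq (f : E3 × E3 → ℝ) : poissonField f = newtonPotential (density f) := rfl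

theorem integrable_newtonPotential_fst_mul {ρ : E3 → ℝ} (hρ : IsRadialDensity ρ)
    {h : E3 × E3 → ℝ} (hh : Integrable h) :
    Integrable fun z : E3 × E3 => newtonPotential ρ z.1 * h z := by
  refine hh.bdd_mul (c := (4 * Real.pi)⁻¹ * ∫ y, ρ y / ‖y‖)
    ((aestronglyMeasurable_newtonPotential hρ).comp_fst (ν := (volume : Measure E3))) ?_
  have hq : ∀ᵐ z : E3 × E3, z.1 ≠ 0 :=
    (Measure.quasiMeasurePreserving_fst (μ := (volume : Measure E3))
      (ν := (volume : Measure E3))).ae (Measure.ae_ne volume (0 : E3))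
  filter_upwards [hq] with z hz
  have := newtonPotential_bounds hρ hz
  rw [Real.norm_eq_abs, abs_of_nonpos this.2]
  linarith

theorem integral_newtonPotential_fst_mul {ρ : E3 → ℝ} (hρ : IsRadialDensity ρ)
    {h : E3 × E3 → ℝ} (hh : Integrable h) :
    ∫ z : E3 × E3, newtonPotential ρ z.1 * h z = ∫ x, newtonPotential ρ x * density h x := by
  rw [Measure.volume_eq_prod, integral_prod _ (integrable_newtonPotential_fst_mul hρ hh)]
  refine integral_congr_ae (Eventually.of_forall fun x => ?_)
  exact integral_const_mul (newtonPotential ρ x) fun v => h (x, v)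

theorem integrable_microEnergy_mul {ρ : E3 → ℝ} (hρ : IsRadialDensity ρ)
    {h : E3 × E3 → ℝ} (hh : FiniteEnergy h) :
    Integrable fun z => microEnergy (newtonPotential ρ) z * h z := by
  refine ((hh.kinetic.div_const 2).add
    (integrable_newtonPotential_fst_mul hρ hh.integrable)).congr
    (Eventually.of_forall fun z => ?_)
  simp only [microEnergy, Pi.add_apply]
  ring

theorem integral_microEnergy_mul {ρ : E3 → ℝ} (hρ : IsRadialDensity ρ)
    {h : E3 × E3 → ℝ} (hh : FiniteEnergy h) :
    ∫ z, microEnergy (newtonPotential ρ) z * h z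
      = (1 / 2) * (∫ z : E3 × E3, ‖z.2‖ ^ 2 * h z) + ∫ x, newtonPotential ρ x * density h x := by
  rw [← integral_newtonPotential_fst_mul hρ hh.integrable, ← integral_const_mul,
    ← integral_add (hh.kinetic.const_mul _)
      (integrable_newtonPotential_fst_mul hρ hh.integrable)]
  refine integral_congr_ae (Eventually.of_forall fun z => ?_)
  simp only [microEnergy]
  ring

/-- Both functionals equal `½∫|∇φ_f|²` plus the integral of the microscopic energy, against `f` and
against its rearrangement respectively: the field energy of the rearrangement cancels when the
square is expanded. -/
theorem hamiltonian_sub_reducedFunctional {g : ENNReal → ℝ → ℝ} (hf : FiniteEnergy f)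
    (hρ : IsRadialDensity (density f)) (hg : FiniteEnergy (rearrangement g (poissonField f)))
    (hρ' : IsRadialDensity (density (rearrangement g (poissonField f)))) :
    hamiltonian f - reducedFunctional g (poissonField f)
      = (∫ z, microEnergy (poissonField f) z * f z)
        - ∫ z, microEnergy (poissonField f) z * rearrangement g (poissonField f) z := by
  set h := rearrangement g (poissonField f) with hh
  rw [reducedFunctional, ← hh, hamiltonian, hamiltonian, poissonField_eq f, poissonField_eq h,
    integral_microEnergy_mul hρ hf, integral_microEnergy_mul hρ hg,
    integral_norm_gradient_sub_sq hρ hρ', integral_norm_gradient_sq hρ]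
  ring

theorem hamiltonian_congr {h h' : E3 × E3 → ℝ} (hae : h =ᵐ[volume] h') :
    hamiltonian h = hamiltonian h' := by
  have hd : density h =ᵐ[volume] density h' := by
    filter_upwards [Measure.ae_ae_of_ae_prod hae] with x hx
    exact integral_congr_ae hx
  -- The fields agree at every point, not merely almost everywhere, so their gradients agree.
  have hp : poissonField h = poissonField h' := by
    ext x
    rw [poissonField, poissonField]
    congr 1
    refine integral_congr_ae ?_
    filter_upwards [hd] with y hy
    rw [hy]
  rw [hamiltonian, hamiltonian, hp]
  congr 2
  refine integral_congr_ae ?_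
  filter_upwards [hae] with z hz
  rw [hz]

end

/-! ### The rearrangement on the fibres of fixed `ℓ`. -/

section

variable {f : E3 × E3 → ℝ} {F : ℝ × ℝ × ℝ → ℝ} {V : ℝ → ℝ} {ρ : E3 → ℝ}

/-- The distribution function in the coordinates `(ℓ, (r, w))`. -/
def phaseDistribution (F : ℝ × ℝ × ℝ → ℝ) (s l : ℝ) : ℝ≥0∞ :=
  radialPhaseMeasure {y | s < phaseProfile F l y}

open Classical in
/-- The pseudo-inverse of `phaseDistribution F · l`. -/
def phaseSchwarz (F : ℝ × ℝ × ℝ → ℝ) (t : ℝ≥0∞) (l : ℝ) : ℝ :=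
  if t < phaseDistribution F 0 l then sSup {s : ℝ | 0 ≤ s ∧ t < phaseDistribution F s l} else 0

open Classical in
/-- The rearrangement of the profile `F` along the energy of `V`, in the coordinates
`(ℓ, (r, w))`. -/
def phaseRearrangement (F : ℝ × ℝ × ℝ → ℝ) (V : ℝ → ℝ) (p : ℝ × (ℝ × ℝ)) : ℝ :=
  if phaseEnergy V p.1 p.2 < 0 then
    phaseSchwarz F (radialPhaseMeasure {y | phaseEnergy V p.1 y < phaseEnergy V p.1 p.2}) p.1
  else 0

theorem antitone_phaseDistribution (F : ℝ × ℝ × ℝ → ℝ) (l : ℝ) :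
    Antitone fun s => phaseDistribution F s l := fun _ s' hs =>
  measure_mono fun y (hy : s' < phaseProfile F l y) => lt_of_le_of_lt hs hy

/-- Right-continuity of the distribution function, by continuity from below of the measure; it makes
the superlevel description of the pseudo-inverse exact. -/
theorem exists_gt_lt_phaseDistribution {t : ℝ≥0∞} {c l : ℝ} (h : t < phaseDistribution F c l) :
    ∃ s > c, t < phaseDistribution F s l := by
  have e1 : {y | c < phaseProfile F l y}
      = ⋃ n : ℕ, {y | c + 1 / ((n : ℝ) + 1) < phaseProfile F l y} := by
    ext y
    simp only [mem_ofPred_eq, mem_iUnion]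
    constructor
    · intro hy
      obtain ⟨n, hn⟩ := exists_nat_one_div_lt (sub_pos.2 hy)
      exact ⟨n, by linarith⟩
    · rintro ⟨n, hn⟩
      have : 0 < 1 / ((n : ℝ) + 1) := by positivity
      linarith
  rw [phaseDistribution, e1, Monotone.measure_iUnion] at h
  · obtain ⟨n, hn⟩ := lt_iSup_iff.1 h
    have : 0 < 1 / ((n : ℝ) + 1) := by positivity
    exact ⟨c + 1 / ((n : ℝ) + 1), by linarith, hn⟩
  · intro i j hij y (hy : c + 1 / ((i : ℝ) + 1) < phaseProfile F l y)
    have := Nat.one_div_le_one_div (α := ℝ) hij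
    exact show c + 1 / ((j : ℝ) + 1) < phaseProfile F l y by linarith

/-- The clause on `n` says that the set under `sSup` is bounded; otherwise `sSup` takes the default
value `0`. Natural numbers keep the condition countable, as needed for measurability. -/
theorem lt_phaseSchwarz_iff {t : ℝ≥0∞} {c l : ℝ} (hc : 0 ≤ c) :
    c < phaseSchwarz F t l
      ↔ t < phaseDistribution F c l ∧ ∃ n : ℕ, ¬ t < phaseDistribution F n l := by
  have hanti := antitone_phaseDistribution F l
  rw [phaseSchwarz]
  split_ifs with h0
  · by_cases hb : ∃ n : ℕ, ¬ t < phaseDistribution F n l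
    · have hbdd : BddAbove {s : ℝ | 0 ≤ s ∧ t < phaseDistribution F s l} := by
        obtain ⟨n, hn⟩ := hb
        refine ⟨n, fun s hs => ?_⟩
        by_contra hlt
        exact hn (hs.2.trans_le (hanti (not_le.1 hlt).le))
      rw [and_iff_left hb]
      constructor
      · intro h
        obtain ⟨s, hs, hcs⟩ := exists_lt_of_lt_csSup
          (show Set.Nonempty {s : ℝ | 0 ≤ s ∧ t < phaseDistribution F s l} from
            ⟨0, show (0 : ℝ) ∈ {s : ℝ | 0 ≤ s ∧ t < phaseDistribution F s l} from ⟨le_rfl, h0⟩⟩) h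
        exact hs.2.trans_le (hanti hcs.le)
      · intro h
        obtain ⟨s, hs, hts⟩ := exists_gt_lt_phaseDistribution h
        exact lt_of_lt_of_le (show c < s from hs) (le_csSup hbdd
          (show s ∈ {s : ℝ | 0 ≤ s ∧ t < phaseDistribution F s l} from ⟨hc.trans hs.le, hts⟩))
    · have hnb : ¬ BddAbove {s : ℝ | 0 ≤ s ∧ t < phaseDistribution F s l} := by
        rintro ⟨B, hB⟩
        push Not at hb
        obtain ⟨n, hn⟩ := exists_nat_gt B
        exact absurd (hB (show (n : ℝ) ∈ {s : ℝ | 0 ≤ s ∧ t < phaseDistribution F s l} from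
          ⟨Nat.cast_nonneg n, hb n⟩)) (not_le.2 hn)
      rw [Real.sSup_of_not_bddAbove hnb]
      exact ⟨fun h => absurd h (not_lt.2 hc), fun h => absurd h.2 hb⟩
  · have : ¬ t < phaseDistribution F c l := fun h => h0 (h.trans_le (hanti hc))
    simp [this, hc]

theorem phaseSchwarz_nonneg (t : ℝ≥0∞) (l : ℝ) : 0 ≤ phaseSchwarz F t l := by
  rw [phaseSchwarz]
  split_ifs
  · exact Real.sSup_nonneg fun s hs => hs.1
  · exact le_rfl

theorem phaseRearrangement_nonneg (p : ℝ × (ℝ × ℝ)) : 0 ≤ phaseRearrangement F V p := by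
  rw [phaseRearrangement]
  split_ifs
  · exact phaseSchwarz_nonneg _ _
  · exact le_rfl

theorem measurable_phaseProfile (hF : Measurable F) :
    Measurable fun p : ℝ × (ℝ × ℝ) => phaseProfile F p.1 p.2 := by
  unfold phaseProfile
  fun_prop

theorem measurable_phaseEnergy (hV : Measurable V) :
    Measurable fun p : ℝ × (ℝ × ℝ) => phaseEnergy V p.1 p.2 := by
  unfold phaseEnergy
  fun_prop

theorem measurable_phaseDistribution (hF : Measurable F) (s : ℝ) :
    Measurable fun l => phaseDistribution F s l :=
  measurable_measure_prodMk_left (s := {p : ℝ × (ℝ × ℝ) | s < phaseProfile F p.1 p.2})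
    (measurableSet_lt measurable_const (measurable_phaseProfile hF))

theorem lt_phaseRearrangement_iff {c : ℝ} (hc : 0 ≤ c) (p : ℝ × (ℝ × ℝ)) :
    c < phaseRearrangement F V p ↔ phaseEnergy V p.1 p.2 < 0 ∧
      radialPhaseMeasure {y | phaseEnergy V p.1 y < phaseEnergy V p.1 p.2}
        < phaseDistribution F c p.1 ∧
      ∃ n : ℕ, ¬ radialPhaseMeasure {y | phaseEnergy V p.1 y < phaseEnergy V p.1 p.2}
        < phaseDistribution F n p.1 := by
  rw [phaseRearrangement]
  split_ifs with h
  · rw [lt_phaseSchwarz_iff hc]; simp [h]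
  · simp [h, hc]

theorem measurable_phaseRearrangement (hF : Measurable F) (hV : Measurable V) :
    Measurable (phaseRearrangement F V) := by
  have hE := measurable_phaseEnergy hV
  have ha : Measurable fun p : ℝ × (ℝ × ℝ) =>
      radialPhaseMeasure {y | phaseEnergy V p.1 y < phaseEnergy V p.1 p.2} :=
    measurable_measure_prodMk_left (s := {q : (ℝ × (ℝ × ℝ)) × (ℝ × ℝ) |
      phaseEnergy V q.1.1 q.2 < phaseEnergy V q.1.1 q.1.2})
      (measurableSet_lt (hE.comp (f := fun q : (ℝ × (ℝ × ℝ)) × (ℝ × ℝ) => (q.1.1, q.2))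
        (by fun_prop)) (hE.comp (f := fun q : (ℝ × (ℝ × ℝ)) × (ℝ × ℝ) => (q.1.1, q.1.2))
        (by fun_prop)))
  have hlt : ∀ s : ℝ, MeasurableSet {p : ℝ × (ℝ × ℝ) |
      radialPhaseMeasure {y | phaseEnergy V p.1 y < phaseEnergy V p.1 p.2}
        < phaseDistribution F s p.1} := fun s =>
    measurableSet_lt ha ((measurable_phaseDistribution hF s).comp measurable_fst)
  refine measurable_of_Ioi fun c => ?_
  rcases lt_or_ge c 0 with hc | hc
  · convert MeasurableSet.univ
    exact eq_univ_of_forall fun p => hc.trans_le (phaseRearrangement_nonneg p)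
  · have e1 : phaseRearrangement F V ⁻¹' Ioi c = {p | phaseEnergy V p.1 p.2 < 0} ∩
        ({p | radialPhaseMeasure {y | phaseEnergy V p.1 y < phaseEnergy V p.1 p.2}
          < phaseDistribution F c p.1} ∩ ⋃ n : ℕ,
          {p | radialPhaseMeasure {y | phaseEnergy V p.1 y < phaseEnergy V p.1 p.2}
          < phaseDistribution F (n : ℝ) p.1}ᶜ) := by
      ext p
      simp only [mem_inter_iff, mem_iUnion, mem_compl_iff, mem_ofPred_eq]
      exact lt_phaseRearrangement_iff hc p
    rw [e1]
    exact (measurableSet_lt hE measurable_const).inter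
      ((hlt c).inter (MeasurableSet.iUnion fun n => (hlt n).compl))

/-- An essential bound on the fibre removes the unboundedness clause, and what remains is the
hypothesis `hlevel` of the bathtub results. -/
theorem superlevel_phaseRearrangement {l K : ℝ} (hbd : phaseDistribution F K l = 0)
    {s : ℝ} (hs : 0 ≤ s) :
    {y | s < phaseRearrangement F V (l, y)}
      = sublevelOfMass radialPhaseMeasure (phaseEnergy V l)
          (radialPhaseMeasure {y | s < phaseProfile F l y}) := by
  ext y
  refine (lt_phaseRearrangement_iff hs (l, y)).trans ?_
  obtain ⟨n, hn⟩ := exists_nat_ge K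
  have h0 : phaseDistribution F (n : ℝ) l = 0 :=
    le_antisymm ((antitone_phaseDistribution F l hn).trans hbd.le) zero_le
  have : ∃ n : ℕ, ¬ radialPhaseMeasure {y' | phaseEnergy V l y' < phaseEnergy V l y}
      < phaseDistribution F (n : ℝ) l := ⟨n, by rw [h0]; exact not_lt_zero⟩
  simp only [this, and_true]
  rfl

theorem phaseRearrangement_le {l K : ℝ} (hK : 0 ≤ K) (hbd : phaseDistribution F K l = 0)
    (y : ℝ × ℝ) : phaseRearrangement F V (l, y) ≤ K := by
  by_contra h
  rw [not_le] at h
  have := ((lt_phaseRearrangement_iff hK (l, y)).1 h).2.1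
  simp only [hbd] at this
  exact not_lt_zero this

theorem ae_radialPhaseMeasure_pos : ∀ᵐ y ∂radialPhaseMeasure, 0 < y.1 := by
  have h : ∀ᵐ r ∂(ENNReal.ofReal (4 * Real.pi ^ 2) • volume.restrict (Ioi (0 : ℝ))), 0 < r :=
    Measure.ae_smul_measure (ae_restrict_mem measurableSet_Ioi) _
  exact Measure.quasiMeasurePreserving_fst.ae h

/-- At fixed `r` the energy is quadratic in `w`, so each slice has at most two points. -/
theorem radialPhaseMeasure_phaseEnergy_eq (hV : Measurable V) (l e : ℝ) :
    radialPhaseMeasure {y | phaseEnergy V l y = e} = 0 := by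
  have hm : MeasurableSet {y | phaseEnergy V l y = e} := by
    unfold phaseEnergy
    exact measurableSet_eq_fun (by fun_prop) measurable_const
  rw [radialPhaseMeasure, Measure.measure_prod_null hm]
  refine Eventually.of_forall fun r => ?_
  set c := 2 * (e - V r) - l / r ^ 2 with hc
  refine measure_mono_null (t := {Real.sqrt c, -Real.sqrt c}) ?_
    (Set.Finite.measure_zero (by simp) _)
  intro w hw
  have hw' : (w ^ 2 + l / r ^ 2) / 2 + V r = e := hw
  have h1 : w ^ 2 = c := by rw [hc]; linarith
  have h2 : w ^ 2 = Real.sqrt c ^ 2 := by rw [Real.sq_sqrt (h1 ▸ sq_nonneg w), h1]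
  exact sq_eq_sq_iff_eq_or_eq_neg.1 h2

/-- The set lies in a box: the `1/r` decay of the potential bounds `r`, and its lower bound gives
`w² ≤ 2C`. -/
theorem radialPhaseMeasure_phaseEnergy_lt_lt_top (hρ : IsRadialDensity ρ) {l : ℝ} (hl : 0 < l)
    {e : ℝ} (he : e < 0) :
    radialPhaseMeasure {y | phaseEnergy (radialPotential ρ) l y < e} < ⊤ := by
  have hpi := Real.pi_pos
  set C := (4 * Real.pi)⁻¹ * ∫ y, ρ y / ‖y‖ with hC
  set M := ∫ y, ρ y with hM
  calc radialPhaseMeasure {y | phaseEnergy (radialPotential ρ) l y < e}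
      ≤ radialPhaseMeasure (Icc 0 (M / (4 * Real.pi * -e)) ×ˢ
          Icc (-Real.sqrt (2 * C)) (Real.sqrt (2 * C))) := by
        refine measure_mono_ae ?_
        filter_upwards [ae_radialPhaseMeasure_pos] with y hy0 hy
        have hy' : (y.2 ^ 2 + l / y.1 ^ 2) / 2 + radialPotential ρ y.1 < e := hy
        have h1 := radialPotential_ge_const hρ y.1
        have h2 := radialPotential_ge_div hρ hy0
        have h3 : 0 < l / y.1 ^ 2 := by positivity
        rw [← hC] at h1
        rw [← hM] at h2
        have h4 : -e < M / (4 * Real.pi * y.1) := by nlinarith [sq_nonneg y.2]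
        rw [lt_div_iff₀ (by positivity)] at h4
        refine mem_prod.2 ⟨⟨hy0.le, ?_⟩, abs_le.1 (Real.abs_le_sqrt (by linarith))⟩
        rw [le_div_iff₀ (by nlinarith)]
        nlinarith
    _ < ⊤ := by
        rw [radialPhaseMeasure, Measure.prod_prod, Measure.smul_apply, smul_eq_mul]
        refine ENNReal.mul_lt_top (ENNReal.mul_lt_top ENNReal.ofReal_lt_top ?_) (by simp)
        exact (Measure.restrict_apply_le _ _).trans_lt (by simp)

theorem exists_radialPhaseMeasure_phaseEnergy_lt_eq_zero (hρ : IsRadialDensity ρ) {l : ℝ}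
    (hl : 0 < l) :
    ∃ c < 0, radialPhaseMeasure {y | phaseEnergy (radialPotential ρ) l y < c} = 0 := by
  have hpi := Real.pi_pos
  have h0 := radialPotential_ge_const hρ 0
  have h0' := radialPotential_nonpos hρ 0
  refine ⟨-((4 * Real.pi)⁻¹ * ∫ y, ρ y / ‖y‖) - 1, by linarith, ?_⟩
  refine measure_mono_null (t := ∅) (fun y hy => ?_) measure_empty
  exfalso
  have hy' : (y.2 ^ 2 + l / y.1 ^ 2) / 2 + radialPotential ρ y.1
    < -((4 * Real.pi)⁻¹ * ∫ y, ρ y / ‖y‖) - 1 := hy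
  have h1 := radialPotential_ge_const hρ y.1
  have h3 : 0 ≤ l / y.1 ^ 2 := by positivity
  nlinarith [sq_nonneg y.2]

end

/-! ### Return to phase space and comparison of microscopic energies. -/

section

variable {f : E3 × E3 → ℝ} {F : ℝ × ℝ × ℝ → ℝ} {V : ℝ → ℝ} {ρ : E3 → ℝ}

theorem ae_fst_ne_zero : ∀ᵐ z : E3 × E3, z.1 ≠ 0 :=
  (Measure.quasiMeasurePreserving_fst (μ := (volume : Measure E3))
    (ν := (volume : Measure E3))).ae (Measure.ae_ne volume (0 : E3))

theorem ae_angularMomentumSq_pos : ∀ᵐ z : E3 × E3, 0 < angularMomentumSq z.1 z.2 := by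
  have h : ∀ᵐ p ∂radialCoordsMeasure, 0 < p.1 :=
    (Measure.quasiMeasurePreserving_fst (μ := volume.restrict (Ioi (0 : ℝ)))
      (ν := radialPhaseMeasure)).ae (ae_restrict_mem measurableSet_Ioi)
  exact measurePreserving_radialCoords.quasiMeasurePreserving.ae h

theorem ae_radialCoordsMeasure_of_ae {p : ℝ × (ℝ × ℝ) → Prop} (hp : MeasurableSet {y | p y})
    (h : ∀ᵐ z, p (radialCoords z)) :
    ∀ᵐ l ∂(volume.restrict (Ioi (0 : ℝ))), ∀ᵐ y ∂radialPhaseMeasure, p (l, y) := by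
  rw [← ae_map_iff measurable_radialCoords.aemeasurable hp,
    measurePreserving_radialCoords.map_eq] at h
  exact Measure.ae_ae_of_ae_prod h

theorem lintegral_eq_iterated {k : E3 × E3 → ℝ≥0∞} {h : ℝ × (ℝ × ℝ) → ℝ≥0∞} (hh : Measurable h)
    (hk : ∀ᵐ z, k z = h (radialCoords z)) :
    ∫⁻ z, k z = ∫⁻ l in Ioi (0 : ℝ), ∫⁻ y, h (l, y) ∂radialPhaseMeasure := by
  rw [lintegral_congr_ae hk, lintegral_radialCoords h hh, radialCoordsMeasure,
    lintegral_prod _ hh.aemeasurable]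

theorem radialVelocity_sq_add {x v : E3} (hx : x ≠ 0) :
    (inner ℝ x v / ‖x‖) ^ 2 + angularMomentumSq x v / ‖x‖ ^ 2 = ‖v‖ ^ 2 := by
  have hx' : ‖x‖ ≠ 0 := norm_ne_zero_iff.2 hx
  rw [angularMomentumSq_eq]
  field_simp
  ring

theorem IsRadialProfile.ae_eq_phaseProfile (hF : IsRadialProfile F f) :
    ∀ᵐ z, f z = phaseProfile F (radialCoords z).1 (radialCoords z).2 := by
  filter_upwards [hF.ae_eq, ae_fst_ne_zero] with z hz hx
  have hx' : ‖z.1‖ ≠ 0 := norm_ne_zero_iff.2 hx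
  rw [hz, phaseProfile, radialCoords]
  simp only
  rw [radialVelocity_sq_add hx, Real.sqrt_sq (norm_nonneg _), mul_div_cancel₀ _ hx']

theorem microEnergy_eq_phaseEnergy (hρ : IsRadialDensity ρ) {z : E3 × E3} (hx : z.1 ≠ 0) :
    microEnergy (newtonPotential ρ) z
      = phaseEnergy (radialPotential ρ) (radialCoords z).1 (radialCoords z).2 := by
  rw [microEnergy, newtonPotential_eq_radialPotential hρ hx, phaseEnergy, radialCoords]
  simp only
  rw [radialVelocity_sq_add hx]

theorem schwarz_eq_phaseSchwarz (hF : Measurable F) (t : ℝ≥0∞) {l : ℝ} (hl : 0 < l) :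
    schwarz F t l = phaseSchwarz F t l := by
  have h : ∀ s, distribution F s l = phaseDistribution F s l := distribution_eq hF hl
  simp only [schwarz, phaseSchwarz, h]

theorem ae_rearrangement_eq (hF : Measurable F) (hρ : IsRadialDensity ρ) :
    ∀ᵐ z, rearrangement (schwarz F) (newtonPotential ρ) z
      = phaseRearrangement F (radialPotential ρ) (radialCoords z) := by
  filter_upwards [ae_fst_ne_zero, ae_angularMomentumSq_pos] with z hx hl
  rw [rearrangement, phaseRearrangement, microEnergy_eq_phaseEnergy hρ hx]
  split_ifs with h
  · rw [jacobian_eq (monotone_radialPotential hρ).measurable _ hl h,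
      schwarz_eq_phaseSchwarz hF _ hl]
    · rfl
    · intro r hr
      have hne : (EuclideanSpace.single 0 r : E3) ≠ 0 := by
        rw [← norm_ne_zero_iff]; simpa using hr.ne'
      rw [newtonPotential_eq_radialPotential hρ hne]
      simp [abs_of_pos hr]
  · rfl

theorem ae_phaseDistribution_eq_zero (hF : IsRadialProfile F f) {K : ℝ} (hK : ∀ᵐ z, f z ≤ K) :
    ∀ᵐ l ∂(volume.restrict (Ioi (0 : ℝ))), phaseDistribution F K l = 0 := by
  have h := ae_radialCoordsMeasure_of_ae (p := fun p => phaseProfile F p.1 p.2 ≤ K)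
    (measurableSet_le (measurable_phaseProfile hF.measurable) measurable_const)
    (by filter_upwards [hF.ae_eq_phaseProfile, hK] with z hz hzK; rwa [← hz])
  filter_upwards [h] with l hl
  rw [ae_iff] at hl
  simpa only [not_le, phaseDistribution] using hl

theorem rearrangement_nonneg (z : E3 × E3) :
    0 ≤ rearrangement (schwarz F) (newtonPotential ρ) z := by
  rw [rearrangement, schwarz]
  split_ifs
  · exact Real.sSup_nonneg fun s hs => hs.1
  · exact le_rfl
  · exact le_rfl

theorem lintegral_rearrangement_le (hf : FiniteEnergy f) (hF : IsRadialProfile F f)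
    (hρ : IsRadialDensity ρ) :
    ∫⁻ z, ENNReal.ofReal (rearrangement (schwarz F) (newtonPotential ρ) z)
      ≤ ∫⁻ z, ENNReal.ofReal (f z) := by
  obtain ⟨K, hK, hfK⟩ := hf.exists_bound
  have hV := (monotone_radialPotential hρ).measurable
  have hG := measurable_phaseRearrangement hF.measurable hV
  have hΦ := measurable_phaseProfile hF.measurable
  rw [lintegral_eq_iterated (h := fun p => ENNReal.ofReal
      (phaseRearrangement F (radialPotential ρ) p)) (by fun_prop)
      ((ae_rearrangement_eq hF.measurable hρ).mono fun z hz => congrArg ENNReal.ofReal hz),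
    lintegral_eq_iterated (h := fun p => ENNReal.ofReal (phaseProfile F p.1 p.2)) (by fun_prop)
      (hF.ae_eq_phaseProfile.mono fun z hz => congrArg ENNReal.ofReal hz)]
  refine lintegral_mono_ae ?_
  filter_upwards [ae_phaseDistribution_eq_zero hF hfK] with l hl
  exact lintegral_rearranged_le (radialPhaseMeasure_phaseEnergy_eq hV l)
    (hΦ.comp measurable_prodMk_left) (hG.comp measurable_prodMk_left)
    fun s hs => superlevel_phaseRearrangement hl hs.le

theorem rearrangement_finiteEnergy (hf : FiniteEnergy f) (hF : IsRadialProfile F f)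
    (hρ : IsRadialDensity ρ) :
    FiniteEnergy (rearrangement (schwarz F) (newtonPotential ρ)) := by
  obtain ⟨K, hK, hfK⟩ := hf.exists_bound
  have hV := (monotone_radialPotential hρ).measurable
  have hG := measurable_phaseRearrangement hF.measurable hV
  have hae := ae_rearrangement_eq hF.measurable hρ
  have hmeas : AEStronglyMeasurable (rearrangement (schwarz F) (newtonPotential ρ)) :=
    ((hG.comp measurable_radialCoords).aestronglyMeasurable).congr (hae.mono fun z hz => hz.symm)
  have hint : Integrable (rearrangement (schwarz F) (newtonPotential ρ)) := by
    refine ⟨hmeas, ?_⟩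
    rw [hasFiniteIntegral_iff_ofReal (Eventually.of_forall rearrangement_nonneg)]
    exact (lintegral_rearrangement_le hf hF hρ).trans_lt hf.integrable.lintegral_lt_top
  have hle : ∀ᵐ z, rearrangement (schwarz F) (newtonPotential ρ) z ≤ K := by
    have hbd : ∀ᵐ p ∂radialCoordsMeasure, phaseDistribution F K p.1 = 0 :=
      (Measure.quasiMeasurePreserving_fst (μ := volume.restrict (Ioi (0 : ℝ)))
        (ν := radialPhaseMeasure)).ae (ae_phaseDistribution_eq_zero hF hfK)
    filter_upwards [hae, measurePreserving_radialCoords.quasiMeasurePreserving.ae hbd] with z hz hb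
    rw [hz]
    exact phaseRearrangement_le hK hb _
  refine ⟨Eventually.of_forall rearrangement_nonneg, hint, ?_, ?_⟩
  · refine memLp_top_of_bound hmeas K (hle.mono fun z hz => ?_)
    rwa [Real.norm_of_nonneg (rearrangement_nonneg z)]
  -- On the support of the rearrangement `|v|²/2 < -φ`, which is bounded, so the kinetic energy is
  -- controlled by the mass.
  · refine (hint.const_mul (2 * ((4 * Real.pi)⁻¹ * ∫ y, ρ y / ‖y‖))).mono'
      ((Measurable.aestronglyMeasurable (f := fun z : E3 × E3 => ‖z.2‖ ^ 2)
        (by fun_prop)).mul hmeas) ?_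
    filter_upwards [ae_fst_ne_zero] with z hx
    have h0 := rearrangement_nonneg (F := F) (ρ := ρ) z
    rw [Real.norm_of_nonneg (by positivity)]
    by_cases hE : microEnergy (newtonPotential ρ) z < 0
    · refine mul_le_mul_of_nonneg_right ?_ h0
      have := (newtonPotential_bounds hρ hx).1
      rw [microEnergy] at hE
      linarith
    · have : rearrangement (schwarz F) (newtonPotential ρ) z = 0 := by
        rw [rearrangement, if_neg hE]
      rw [this, mul_zero, mul_zero]

theorem rearrangement_exists_radialProfile (hF : IsRadialProfile F f)
    (hρ : IsRadialDensity ρ) :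
    ∃ F', IsRadialProfile F' (rearrangement (schwarz F) (newtonPotential ρ)) := by
  have hV := (monotone_radialPotential hρ).measurable
  have hG := measurable_phaseRearrangement hF.measurable hV
  -- All three coordinates depend on `(|x|, |v|, x·v)` alone: `ℓ = |x|²|v|² - (x·v)²` and `w =
  -- x·v/|x|`.
  refine ⟨fun q => phaseRearrangement F (radialPotential ρ)
    (q.1 ^ 2 * q.2.1 ^ 2 - q.2.2 ^ 2, (q.1, q.2.2 / q.1)), by fun_prop, ?_⟩
  filter_upwards [ae_rearrangement_eq hF.measurable hρ] with z hz
  rw [hz, radialCoords, angularMomentumSq_eq]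

/-- The bathtub principle on almost every fibre, integrated in `ℓ`. Global equality forces equality
on almost every fibre, where the equality case applies. -/
theorem lintegral_binding_rearrangement_le (hf : FiniteEnergy f) (hF : IsRadialProfile F f)
    (hρ : IsRadialDensity ρ) :
    ∫⁻ z, ENNReal.ofReal (-microEnergy (newtonPotential ρ) z) * ENNReal.ofReal (f z)
      ≤ ∫⁻ z, ENNReal.ofReal (-microEnergy (newtonPotential ρ) z)
          * ENNReal.ofReal (rearrangement (schwarz F) (newtonPotential ρ) z) ∧
    (∫⁻ z, ENNReal.ofReal (microEnergy (newtonPotential ρ) z) * ENNReal.ofReal (f z) = 0 →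
      ∫⁻ z, ENNReal.ofReal (-microEnergy (newtonPotential ρ) z)
          * ENNReal.ofReal (rearrangement (schwarz F) (newtonPotential ρ) z) ≠ ⊤ →
      ∫⁻ z, ENNReal.ofReal (-microEnergy (newtonPotential ρ) z) * ENNReal.ofReal (f z)
        = ∫⁻ z, ENNReal.ofReal (-microEnergy (newtonPotential ρ) z)
          * ENNReal.ofReal (rearrangement (schwarz F) (newtonPotential ρ) z) →
      f =ᵐ[volume] rearrangement (schwarz F) (newtonPotential ρ)) := by
  obtain ⟨K, hK, hfK⟩ := hf.exists_bound
  have hV := (monotone_radialPotential hρ).measurable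
  have hG := measurable_phaseRearrangement hF.measurable hV
  have hΦ := measurable_phaseProfile hF.measurable
  have hE := measurable_phaseEnergy hV
  have e1 := lintegral_eq_iterated
    (k := fun z => ENNReal.ofReal (-microEnergy (newtonPotential ρ) z) *
      ENNReal.ofReal (f z))
    (h := fun p => ENNReal.ofReal (-phaseEnergy (radialPotential ρ) p.1 p.2) *
      ENNReal.ofReal (phaseProfile F p.1 p.2))
    (by fun_prop) (by
      filter_upwards [hF.ae_eq_phaseProfile, ae_fst_ne_zero] with z hz hx
      rw [microEnergy_eq_phaseEnergy hρ hx, hz])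
  have e2 := lintegral_eq_iterated
    (k := fun z => ENNReal.ofReal (-microEnergy (newtonPotential ρ) z) *
      ENNReal.ofReal (rearrangement (schwarz F) (newtonPotential ρ) z))
    (h := fun p => ENNReal.ofReal (-phaseEnergy (radialPotential ρ) p.1 p.2) *
      ENNReal.ofReal (phaseRearrangement F (radialPotential ρ) p))
    (by fun_prop) (by
      filter_upwards [ae_rearrangement_eq hF.measurable hρ, ae_fst_ne_zero] with z hz hx
      rw [microEnergy_eq_phaseEnergy hρ hx, hz])
  have e3 := lintegral_eq_iterated
    (k := fun z => ENNReal.ofReal (microEnergy (newtonPotential ρ) z) *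
      ENNReal.ofReal (f z))
    (h := fun p => ENNReal.ofReal (phaseEnergy (radialPotential ρ) p.1 p.2) *
      ENNReal.ofReal (phaseProfile F p.1 p.2))
    (by fun_prop) (by
      filter_upwards [hF.ae_eq_phaseProfile, ae_fst_ne_zero] with z hz hx
      rw [microEnergy_eq_phaseEnergy hρ hx, hz])
  have e4 := lintegral_eq_iterated
    (k := fun z => ENNReal.ofReal (f z))
    (h := fun p => ENNReal.ofReal (phaseProfile F p.1 p.2))
    (by fun_prop) (by
      filter_upwards [hF.ae_eq_phaseProfile] with z hz
      rw [hz])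
  have hΦfin := hf.integrable.lintegral_lt_top
  rw [e1, e2, e3]
  rw [e4] at hΦfin
  have hfiber : ∀ᵐ l ∂(volume.restrict (Ioi (0 : ℝ))),
      ∫⁻ y, ENNReal.ofReal (-phaseEnergy (radialPotential ρ) l y) *
        ENNReal.ofReal (phaseProfile F l y) ∂radialPhaseMeasure
      ≤ ∫⁻ y, ENNReal.ofReal (-phaseEnergy (radialPotential ρ) l y) *
        ENNReal.ofReal (phaseRearrangement F (radialPotential ρ) (l, y)) ∂radialPhaseMeasure := by
    filter_upwards [ae_phaseDistribution_eq_zero hF hfK, ae_restrict_mem measurableSet_Ioi]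
      with l hl hl0
    exact lintegral_binding_le (hE.comp measurable_prodMk_left)
      (radialPhaseMeasure_phaseEnergy_eq hV l)
      (fun e he => radialPhaseMeasure_phaseEnergy_lt_lt_top hρ hl0 he)
      (exists_radialPhaseMeasure_phaseEnergy_lt_eq_zero hρ hl0)
      (hΦ.comp measurable_prodMk_left) (hG.comp measurable_prodMk_left)
      fun s hs => superlevel_phaseRearrangement hl hs.le
  have hGm : Measurable fun l => ∫⁻ y, ENNReal.ofReal (-phaseEnergy (radialPotential ρ) l y) *
      ENNReal.ofReal (phaseRearrangement F (radialPotential ρ) (l, y)) ∂radialPhaseMeasure :=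
    Measurable.lintegral_prod_right' (f := fun p : ℝ × (ℝ × ℝ) =>
      ENNReal.ofReal (-phaseEnergy (radialPotential ρ) p.1 p.2) *
      ENNReal.ofReal (phaseRearrangement F (radialPotential ρ) p)) (by fun_prop)
  have hPm : Measurable fun l => ∫⁻ y, ENNReal.ofReal (phaseEnergy (radialPotential ρ) l y) *
      ENNReal.ofReal (phaseProfile F l y) ∂radialPhaseMeasure :=
    Measurable.lintegral_prod_right' (f := fun p : ℝ × (ℝ × ℝ) =>
      ENNReal.ofReal (phaseEnergy (radialPotential ρ) p.1 p.2) *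
      ENNReal.ofReal (phaseProfile F p.1 p.2)) (by fun_prop)
  have hΦm : Measurable fun l => ∫⁻ y, ENNReal.ofReal (phaseProfile F l y) ∂radialPhaseMeasure :=
    Measurable.lintegral_prod_right' (f := fun p : ℝ × (ℝ × ℝ) =>
      ENNReal.ofReal (phaseProfile F p.1 p.2)) (by fun_prop)
  refine ⟨lintegral_mono_ae hfiber, fun hpos hfin heq => ?_⟩
  have heq' := ae_eq_of_ae_le_of_lintegral_le hfiber (by rw [heq]; exact hfin)
    hGm.aemeasurable heq.ge
  rw [lintegral_eq_zero_iff hPm] at hpos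
  have hae : ∀ᵐ l ∂(volume.restrict (Ioi (0 : ℝ))), ∀ᵐ y ∂radialPhaseMeasure,
      ENNReal.ofReal (phaseProfile F l y)
        = ENNReal.ofReal (phaseRearrangement F (radialPotential ρ) (l, y)) := by
    filter_upwards [ae_phaseDistribution_eq_zero hF hfK, ae_restrict_mem measurableSet_Ioi, heq',
      hpos, ae_lt_top hGm hfin, ae_lt_top hΦm hΦfin.ne] with l hl hl0 h1 h2 h3 h4
    exact ae_eq_of_lintegral_binding_eq (hE.comp measurable_prodMk_left)
      (radialPhaseMeasure_phaseEnergy_eq hV l)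
      (fun e he => radialPhaseMeasure_phaseEnergy_lt_lt_top hρ hl0 he)
      (exists_radialPhaseMeasure_phaseEnergy_lt_eq_zero hρ hl0)
      (hΦ.comp measurable_prodMk_left) (hG.comp measurable_prodMk_left)
      (fun s hs => superlevel_phaseRearrangement hl hs.le) h4.ne h2 h3.ne h1
  have hae' : ∀ᵐ p ∂radialCoordsMeasure, ENNReal.ofReal (phaseProfile F p.1 p.2)
      = ENNReal.ofReal (phaseRearrangement F (radialPotential ρ) p) :=
    (Measure.ae_prod_iff_ae_ae (measurableSet_eq_fun (by fun_prop) (by fun_prop))).2 hae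
  filter_upwards [measurePreserving_radialCoords.quasiMeasurePreserving.ae hae',
    hF.ae_eq_phaseProfile, ae_rearrangement_eq hF.measurable hρ, hf.nonneg] with z h1 h2 h3 h4
  rw [← h2, ← h3] at h1
  exact (ENNReal.ofReal_eq_ofReal_iff h4 (rearrangement_nonneg z)).1 h1

theorem integral_mul_eq_toReal_sub {X : Type*} [MeasurableSpace X] {μ : Measure X} {E h : X → ℝ}
    (hh : ∀ᵐ x ∂μ, 0 ≤ h x) (hint : Integrable (fun x => E x * h x) μ) :
    ∫ x, E x * h x ∂μ = (∫⁻ x, ENNReal.ofReal (E x) * ENNReal.ofReal (h x) ∂μ).toReal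
      - (∫⁻ x, ENNReal.ofReal (-E x) * ENNReal.ofReal (h x) ∂μ).toReal := by
  rw [integral_eq_lintegral_pos_part_sub_lintegral_neg_part hint]
  congr 2
  · refine lintegral_congr_ae ?_
    filter_upwards [hh] with x hx
    rw [ENNReal.ofReal_mul' hx]
  · refine lintegral_congr_ae ?_
    filter_upwards [hh] with x hx
    rw [← neg_mul, ENNReal.ofReal_mul' hx]

theorem lintegral_ofReal_mul_ofReal_ne_top {X : Type*} [MeasurableSpace X] {μ : Measure X}
    {E h : X → ℝ} (hh : ∀ᵐ x ∂μ, 0 ≤ h x) (hint : Integrable (fun x => E x * h x) μ) :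
    ∫⁻ x, ENNReal.ofReal (E x) * ENNReal.ofReal (h x) ∂μ ≠ ⊤ := by
  refine ne_of_lt (lt_of_eq_of_lt (lintegral_congr_ae ?_) hint.lintegral_lt_top)
  filter_upwards [hh] with x hx
  rw [ENNReal.ofReal_mul' hx]

/-- Split `E` into positive and negative parts. The rearrangement has no mass where `E ≥ 0`, so it
gains in both parts; equality means that `f` has no mass at positive energy and the same binding
energy. -/
theorem integral_microEnergy_rearrangement_le (hf : FiniteEnergy f) (hF : IsRadialProfile F f)
    (hρ : IsRadialDensity ρ) :
    ∫ z, microEnergy (newtonPotential ρ) z * rearrangement (schwarz F) (newtonPotential ρ) z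
      ≤ ∫ z, microEnergy (newtonPotential ρ) z * f z ∧
    (∫ z, microEnergy (newtonPotential ρ) z * rearrangement (schwarz F) (newtonPotential ρ) z
      = ∫ z, microEnergy (newtonPotential ρ) z * f z →
      f =ᵐ[volume] rearrangement (schwarz F) (newtonPotential ρ)) := by
  have hg := rearrangement_finiteEnergy hf hF hρ
  have hfi := integrable_microEnergy_mul hρ hf
  have hgi := integrable_microEnergy_mul hρ hg
  obtain ⟨hle, heq⟩ := lintegral_binding_rearrangement_le hf hF hρ
  have hfi' : Integrable fun z => -microEnergy (newtonPotential ρ) z * f z := by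
    exact hfi.neg.congr (Eventually.of_forall fun z => (neg_mul _ _).symm)
  have hgi' : Integrable fun z => -microEnergy (newtonPotential ρ) z *
      rearrangement (schwarz F) (newtonPotential ρ) z := by
    exact hgi.neg.congr (Eventually.of_forall fun z => (neg_mul _ _).symm)
  have hP := lintegral_ofReal_mul_ofReal_ne_top hf.nonneg hfi
  have hN := lintegral_ofReal_mul_ofReal_ne_top hf.nonneg hfi'
  have hN' := lintegral_ofReal_mul_ofReal_ne_top hg.nonneg hgi'
  have hP' : ∫⁻ z, ENNReal.ofReal (microEnergy (newtonPotential ρ) z) *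
      ENNReal.ofReal (rearrangement (schwarz F) (newtonPotential ρ) z) = 0 := by
    refine (lintegral_congr fun z => ?_).trans lintegral_zero
    by_cases h : microEnergy (newtonPotential ρ) z < 0
    · rw [ENNReal.ofReal_of_nonpos h.le, zero_mul]
    · rw [rearrangement, if_neg h, ENNReal.ofReal_zero, mul_zero]
  rw [integral_mul_eq_toReal_sub hf.nonneg hfi, integral_mul_eq_toReal_sub hg.nonneg hgi, hP',
    ENNReal.toReal_zero]
  have hle' := ENNReal.toReal_mono hN' hle
  have hP0 := ENNReal.toReal_nonneg
    (a := ∫⁻ z, ENNReal.ofReal (microEnergy (newtonPotential ρ) z) * ENNReal.ofReal (f z))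
  refine ⟨by linarith, fun h => heq ?_ hN' ?_⟩
  · have h0 : (∫⁻ z, ENNReal.ofReal (microEnergy (newtonPotential ρ) z) *
      ENNReal.ofReal (f z)).toReal = 0 := by linarith
    exact ((ENNReal.toReal_eq_zero_iff _).1 h0).resolve_right hP
  · exact (ENNReal.toReal_eq_toReal_iff' hN hN').1 (by linarith)

end

end VlasovPoisson

end

/-! ### The chain of inequalities and the equality case. -/

theorem proposition4p1
    (f : VlasovPoisson.E3 × VlasovPoisson.E3 → ℝ) (F : ℝ × ℝ × ℝ → ℝ)
    (hf : VlasovPoisson.FiniteEnergy f)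
    (hF : VlasovPoisson.IsRadialProfile F f)
    (hne : ¬ f =ᵐ[MeasureTheory.volume] 0) :
    (VlasovPoisson.RadialFiniteEnergy (VlasovPoisson.selfRearrangement f F)
      ∧ VlasovPoisson.HasFiniteFieldEnergy (VlasovPoisson.poissonField f)
      ∧ VlasovPoisson.HasFiniteFieldEnergy
          (VlasovPoisson.poissonField (VlasovPoisson.selfRearrangement f F)))
    ∧ (VlasovPoisson.hamiltonian f
          ≥ VlasovPoisson.reducedFunctional (VlasovPoisson.schwarz F)
              (VlasovPoisson.poissonField f)
      ∧ VlasovPoisson.reducedFunctional (VlasovPoisson.schwarz F)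
              (VlasovPoisson.poissonField f)
          ≥ VlasovPoisson.hamiltonian (VlasovPoisson.selfRearrangement f F))
    ∧ (VlasovPoisson.hamiltonian f
          = VlasovPoisson.hamiltonian (VlasovPoisson.selfRearrangement f F)
        ↔ f =ᵐ[MeasureTheory.volume] VlasovPoisson.selfRearrangement f F) := by
  have hρ := VlasovPoisson.isRadialDensity_density hf hF
  have hg : VlasovPoisson.FiniteEnergy (VlasovPoisson.selfRearrangement f F) :=
    VlasovPoisson.rearrangement_finiteEnergy hf hF hρ
  obtain ⟨F', hF'⟩ : ∃ F', VlasovPoisson.IsRadialProfile F'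
    (VlasovPoisson.selfRearrangement f F) :=
    VlasovPoisson.rearrangement_exists_radialProfile hF hρ
  have hρ' := VlasovPoisson.isRadialDensity_density hg hF'
  have hdiff := VlasovPoisson.hamiltonian_sub_reducedFunctional hf hρ hg hρ'
  obtain ⟨hle, heq⟩ := VlasovPoisson.integral_microEnergy_rearrangement_le hf hF hρ
  have hge : VlasovPoisson.hamiltonian f
      ≥ VlasovPoisson.reducedFunctional (VlasovPoisson.schwarz F)
        (VlasovPoisson.poissonField f) := by
    have : (0 : ℝ) ≤ _ := sub_nonneg.2 hle
    exact sub_nonneg.1 (this.trans hdiff.ge)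
  have hge' : VlasovPoisson.reducedFunctional (VlasovPoisson.schwarz F)
      (VlasovPoisson.poissonField f)
        ≥ VlasovPoisson.hamiltonian (VlasovPoisson.selfRearrangement f F) := by
    refine le_add_of_nonneg_right (mul_nonneg (by norm_num) ?_)
    exact integral_nonneg fun x => by positivity
  refine ⟨⟨⟨hg, F', hF'⟩, VlasovPoisson.hasFiniteFieldEnergy_newtonPotential hρ,
    VlasovPoisson.hasFiniteFieldEnergy_newtonPotential hρ'⟩, ⟨hge, hge'⟩, fun h => heq ?_,
    VlasovPoisson.hamiltonian_congr⟩
  -- Equal Hamiltonians collapse the chain `H(f) ≥ J(φ_f) ≥ H(f^{*φ_f})`, so the difference of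
  -- microscopic energies vanishes.
  refine le_antisymm hle (sub_nonpos.1 (hdiff.symm.le.trans (sub_nonpos.2 ?_)))
  exact h.le.trans hge'
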